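/- Let $\hat e_1=(1,0)$, $\hat e_2=\tfrac12(1,\sqrt3)$, $\hat e_3=\tfrac12(-1,\sqrt3)$, and let $\mathcal L=\mathbb Z\hat e_1+\mathbb Z\hat e_2$ be the triangular lattice, with sublattices $\mathcal L^1=\mathbb Z(\hat e_1+\hat e_2)+\mathbb Z(\hat e_2+\hat e_3)$, $\mathcal L^2=\mathcal L^1+\hat e_1$, $\mathcal L^3=\mathcal L^1+\hat e_2$. For $\varepsilon>0$ let $\mathcal T_\varepsilon$ be the family of closed triangles $T=\mathrm{conv}\{\varepsilon i,\varepsilon j,\varepsilon k\}$ with $i,j,k\in\mathcal L$ and $|i-j|=|j-k|=|k-i|=1$; the vertices are always labelled so that $i\in\mathcal L^1$, $j\in\mathcal L^2$, $k\in\mathcal L^3$. For a spin field $u\colon\varepsilon\mathcal L\to\mathbb S^1$ and $T\in\mathcal T_\varepsilon$ put $$F_\varepsilon(u,T)=\varepsilon\,|u(\varepsilon i)+u(\varepsilon j)+u(\varepsilon k)|^2,\qquad \chi(u,T)=\frac{2}{3\sqrt3}\big(u(\varepsilon i)\times u(\varepsilon j)+u(\varepsilon j)\times u(\varepsilon k)+u(\varepsilon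 k)\times u(\varepsilon i)\big),$$ where $v\times w=v_1w_2-v_2w_1$. Let $\Omega\subset\mathbb R^2$ be open and bounded, let $F_\varepsilon(u)=\sum_{T\in\mathcal T_\varepsilon,\,T\subset\Omega}F_\varepsilon(u,T)$, and let $\chi(u)$ be the (almost everywhere defined) function on $\Omega$ with $\chi(u)=\chi(u,T)$ on $\Omega\cap\mathrm{int}\,T$ for every $T\in\mathcal T_\varepsilon$. Let $\varepsilon_n>0$ with $\varepsilon_n\to0$, and let $u_n\colon\varepsilon_n\mathcal L\to\mathbb S^1$ be spin fields with $\sup_n F_{\varepsilon_n}(u_n)<+\infty$. Then $\chi(u_n)\in L^1(\Omega)$ for every $n$, and there exist $\chi\in BV(\Omega;\{-1,1\})$ (that is, $\chi\in L^1(\Omega)$ has finite total variation in $\Omega$ and takes values in $\{-1,1\}$ almost everywhere) and a subsequence along which $\chi(u_n)\to\chi$ in $L^1(\Omega)$. -/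

import Mathlib

open MeasureTheory Filter Topology
open scoped ENNReal Pointwise

noncomputable section

namespace TriXY

/-- The Euclidean plane. -/
abbrev Plane := EuclideanSpace ℝ (Fin 2)

def e1 : Plane := !₂[1, 0]

def e2 : Plane := !₂[1 / 2, √3 / 2]

def e3 : Plane := !₂[-1 / 2, √3 / 2]

/-- The triangular lattice `ℒ`. -/
def lattice : Set Plane := {x | ∃ z₁ z₂ : ℤ, x = (z₁ : ℝ) • e1 + (z₂ : ℝ) • e2}

/-- The sublattice `ℒ¹`. -/
def sublattice1 : Set Plane :=
  {x | ∃ z₁ z₂ : ℤ, x = (z₁ : ℝ) • (e1 + e2) + (z₂ : ℝ) • (e2 + e3)}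

/-- The sublattice `ℒ² = ℒ¹ + ê₁`. -/
def sublattice2 : Set Plane := {x | ∃ y ∈ sublattice1, x = y + e1}

/-- The sublattice `ℒ³ = ℒ¹ + ê₂`. -/
def sublattice3 : Set Plane := {x | ∃ y ∈ sublattice1, x = y + e2}

/-- The triangles of the lattice `ℒ`. Two lattice points at distance one never lie in the same
sublattice, so the three vertices of a lattice triangle lie in the three different sublattices;
a triangle is recorded by its vertices `i ∈ ℒ¹`, `j ∈ ℒ²`, `k ∈ ℒ³`, in exactly one way. -/
structure Triangle where
  i : Plane
  j : Plane
  k : Plane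
  i_mem : i ∈ lattice
  j_mem : j ∈ lattice
  k_mem : k ∈ lattice
  i_mem1 : i ∈ sublattice1
  j_mem2 : j ∈ sublattice2
  k_mem3 : k ∈ sublattice3
  dist_ij : ‖i - j‖ = 1
  dist_jk : ‖j - k‖ = 1
  dist_ki : ‖k - i‖ = 1

/-- The rescaled closed triangle `conv {ε i, ε j, ε k}`. -/
def Triangle.carrier (T : Triangle) (ε : ℝ) : Set Plane :=
  convexHull ℝ {ε • T.i, ε • T.j, ε • T.k}

/-- Spin fields `u : ε ℒ → 𝕊¹`. -/
abbrev SpinField (ε : ℝ) := (ε • lattice : Set Plane) → Metric.sphere (0 : Plane) 1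

/-- The three spins of `u` at the vertices `ε i`, `ε j`, `ε k` of a triangle. -/
def spinI {ε : ℝ} (u : SpinField ε) (T : Triangle) : Plane :=
  u ⟨ε • T.i, Set.smul_mem_smul_set T.i_mem⟩

def spinJ {ε : ℝ} (u : SpinField ε) (T : Triangle) : Plane :=
  u ⟨ε • T.j, Set.smul_mem_smul_set T.j_mem⟩

def spinK {ε : ℝ} (u : SpinField ε) (T : Triangle) : Plane :=
  u ⟨ε • T.k, Set.smul_mem_smul_set T.k_mem⟩

/-- The energy `F_ε(u, T) = ε |u(ε i) + u(ε j) + u(ε k)|²`. -/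
def triangleEnergy {ε : ℝ} (u : SpinField ε) (T : Triangle) : ℝ :=
  ε * ‖spinI u T + spinJ u T + spinK u T‖ ^ 2

/-- The energy `F_ε(u, A)`: the sum over all triangles of the lattice `ε ℒ` contained in `A`. -/
def energy {ε : ℝ} (u : SpinField ε) (A : Set Plane) : ℝ≥0∞ :=
  ∑' T : {T : Triangle // T.carrier ε ⊆ A}, ENNReal.ofReal (triangleEnergy u T.1)

/-- The cross product in the plane. -/
def cross (v w : Plane) : ℝ := v 0 * w 1 - v 1 * w 0

/-- The chirality `χ(u, T)` of `u` on a triangle. -/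
def triangleChirality {ε : ℝ} (u : SpinField ε) (T : Triangle) : ℝ :=
  2 / (3 * √3) * (cross (spinI u T) (spinJ u T) + cross (spinJ u T) (spinK u T)
    + cross (spinK u T) (spinI u T))

open Classical in
/-- The chirality `χ(u)`: the function equal to `χ(u, T)` on the interior of each triangle `T`.
The interiors of the triangles are pairwise disjoint, so there is at most one `T` to choose; on
the null set of points in no such interior the value is `0`. -/
def chirality {ε : ℝ} (u : SpinField ε) (x : Plane) : ℝ :=
  if h : ∃ T : Triangle, x ∈ interior (T.carrier ε) then triangleChirality u h.choose else 0

/-- The divergence of a vector field. -/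
def divergence (φ : Plane → Plane) (x : Plane) : ℝ :=
  ∑ m : Fin 2, fderiv ℝ φ x (EuclideanSpace.single m 1) m

/-- `φ ∈ C¹_c(Ω; ℝ²)` with `|φ| ≤ 1`. -/
def IsTestField (Ω : Set Plane) (φ : Plane → Plane) : Prop :=
  ContDiff ℝ 1 φ ∧ HasCompactSupport φ ∧ tsupport φ ⊆ Ω ∧ ∀ x, ‖φ x‖ ≤ 1

/-- The total variation of `f` in `Ω`. -/
def totalVariation (f : Plane → ℝ) (Ω : Set Plane) : ℝ≥0∞ :=
  ⨆ (φ : Plane → Plane) (_ : IsTestField Ω φ),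
    ENNReal.ofReal (∫ x in Ω, f x * divergence φ x)

/-- `f ∈ BV(Ω; {-1, 1})`. -/
def MemBVSign (f : Plane → ℝ) (Ω : Set Plane) : Prop :=
  IntegrableOn f Ω ∧ totalVariation f Ω < ⊤ ∧
    ∀ᵐ x ∂(volume.restrict Ω), f x = -1 ∨ f x = 1

end TriXY

end

/-! Three unit vectors with zero sum point to the corners of an equilateral triangle, and their
chirality is `1` or `-1`. With spin sum `S`, the chirality is within `11 * ‖S‖` of its sign
(`abs_signOf_spinChirality_sub_le`). Two lattice triangles with a common edge run through its
endpoints in the same cyclic order, since the order is dictated by the sublattices. Their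
chiralities therefore differ by at most the sum of the two norms `‖S‖` (`abs_spinChirality_sub_le`).
So the signs of neighbouring cells differ by a multiple of the spin sums; as this difference is `0`
or `2`, the linear bound can be squared (`abs_sub_le_of_sign`), and the squares are what the energy
measures.

The plane is cut into rhombic cells of side `ε`, each made of a lower and an upper triangle, and
`signField` is constant on cells. A jump between adjacent cells costs energy of order `ε`, the
length of their common side, so the energy bounds the variation of the sign field. The precise form
is the translation estimate `lintegral_signField_add_sub_le`, linear in `t + ε`. It holds at a
distance from the boundary, because only triangles inside `Ω` carry energy.

This estimate yields compactness through a Kolmogorov–Riesz argument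
(`exists_subseq_tendsto_of_translate`). With step `ε` it also bounds the limit tested against
derivatives, by a discrete integration by parts (`enorm_setIntegral_signField_mul_le`). Finally, the
integral of the excess is of order `ε` (`lintegral_excessField_le`), so chirality and sign field
have the same limit in `L¹`. -/

noncomputable section

namespace TriXY

/-! ### Chirality of three nearly cancelling unit vectors -/

/-- The chirality of three spins. -/
def spinChirality (u v w : Plane) : ℝ :=
  2 / (3 * √3) * (cross u v + cross v w + cross w u)

/-- The sign of a real number, with the convention that zero is positive. -/
def signOf (c : ℝ) : ℝ := if 0 ≤ c then 1 else -1

theorem signOf_eq (c : ℝ) : signOf c = -1 ∨ signOf c = 1 := by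
  unfold signOf
  split_ifs <;> simp

theorem abs_signOf (c : ℝ) : |signOf c| = 1 := by
  rcases signOf_eq c with h | h <;> simp [h]

/-- In the factorization of `c ^ 2 - 1`, the factor that measures the distance to the other sign is
at least one. -/
theorem abs_signOf_sub_le (c : ℝ) : |signOf c - c| ≤ |c ^ 2 - 1| := by
  unfold signOf
  split_ifs with h
  · have : c ^ 2 - 1 = (c - 1) * (c + 1) := by ring
    rw [this, abs_mul, abs_sub_comm, abs_of_nonneg (by linarith : 0 ≤ c + 1)]
    nlinarith [abs_nonneg (c - 1)]
  · have : c ^ 2 - 1 = (-1 - c) * (1 - c) := by ring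
    rw [this, abs_mul, abs_of_nonneg (by linarith : 0 ≤ 1 - c)]
    nlinarith [abs_nonneg (-1 - c)]

theorem plane_norm_sq (v : Plane) : ‖v‖ ^ 2 = v 0 ^ 2 + v 1 ^ 2 := by
  rw [EuclideanSpace.real_norm_sq_eq, Fin.sum_univ_two]

theorem abs_cross_le (v w : Plane) : |cross v w| ≤ ‖v‖ * ‖w‖ := by
  apply abs_le_of_sq_le_sq _ (by positivity)
  rw [mul_pow, plane_norm_sq, plane_norm_sq, cross]
  nlinarith [sq_nonneg (v 0 * w 0 + v 1 * w 1)]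

theorem spinChirality_rotate (u v w : Plane) : spinChirality v w u = spinChirality u v w := by
  unfold spinChirality
  ring

theorem two_div_three_sqrt_three_le : 2 / (3 * √3) ≤ 1 / 2 := by
  have h : (4 / 3 : ℝ) ≤ √3 := Real.le_sqrt_of_sq_le (by norm_num)
  rw [div_le_div_iff₀ (by positivity) (by norm_num)]
  linarith

theorem two_div_three_sqrt_three_sq : (2 / (3 * √3)) ^ 2 = 4 / 27 := by
  rw [div_pow, mul_pow, Real.sq_sqrt (by norm_num)]
  norm_num

theorem abs_spinChirality_le {u v w : Plane} (hu : ‖u‖ = 1) (hv : ‖v‖ = 1) (hw : ‖w‖ = 1) :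
    |spinChirality u v w| ≤ 2 := by
  unfold spinChirality
  have h1 := abs_cross_le u v
  have h2 := abs_cross_le v w
  have h3 := abs_cross_le w u
  rw [hu, hv] at h1
  rw [hv, hw] at h2
  rw [hw, hu] at h3
  have h0 : 0 ≤ 2 / (3 * √3) := by positivity
  rw [abs_mul, abs_of_nonneg h0]
  have h4 : |cross u v + cross v w + cross w u| ≤ 3 :=
    (abs_add_three _ _ _).trans (by linarith)
  have := two_div_three_sqrt_three_le
  nlinarith [abs_nonneg (cross u v + cross v w + cross w u)]

theorem norm_add_three_le_three {u v w : Plane} (hu : ‖u‖ = 1) (hv : ‖v‖ = 1) (hw : ‖w‖ = 1) :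
    ‖u + v + w‖ ≤ 3 :=
  (norm_add₃_le).trans (by linarith)

/-- The chirality is close to `±1` where the three spins nearly cancel. -/
theorem abs_spinChirality_sq_sub_one_le {u v w : Plane} (hu : ‖u‖ = 1) (hv : ‖v‖ = 1)
    (hw : ‖w‖ = 1) : |spinChirality u v w ^ 2 - 1| ≤ 11 * ‖u + v + w‖ := by
  obtain ⟨S, hS⟩ : ∃ S, S = u + v + w := ⟨_, rfl⟩
  have hw' : w = S - u - v := by rw [hS]; abel
  have hs3 : ‖S‖ ≤ 3 := hS ▸ norm_add_three_le_three hu hv hw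
  rw [← hS]
  set s := ‖S‖ with hs
  have hs0 : 0 ≤ s := norm_nonneg _
  have hss : s ^ 2 ≤ 3 * s := by nlinarith
  have hu2 := plane_norm_sq u
  have hv2 := plane_norm_sq v
  have hw2 := plane_norm_sq w
  have hS2 := plane_norm_sq S
  rw [hu] at hu2
  rw [hv] at hv2
  rw [hw] at hw2
  rw [← hs] at hS2
  -- Eliminating `w` makes the chirality a multiple of `3 * κ + τ`, where only `κ` survives as `S`
  -- tends to zero. The condition `‖w‖ = 1` forces `d` towards `-1 / 2`, hence `κ ^ 2` towards `3 /
  -- 4`.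
  set κ := cross u v with hκ
  set τ := cross S (u - v) with hτ
  set d := u 0 * v 0 + u 1 * v 1 with hd
  set p := inner ℝ S (u + v) with hp
  have hκ1 : |κ| ≤ 1 := by simpa [hu, hv] using abs_cross_le u v
  have huv : ‖u - v‖ ≤ 2 := (norm_sub_le _ _).trans (by linarith)
  have huv' : ‖u + v‖ ≤ 2 := (norm_add_le _ _).trans (by linarith)
  have hτ1 : |τ| ≤ 2 * s := (abs_cross_le _ _).trans
    ((mul_le_mul_of_nonneg_left huv hs0).trans_eq (mul_comm _ _))
  have hp1 : |p| ≤ 2 * s := (abs_real_inner_le_norm _ _).trans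
    ((mul_le_mul_of_nonneg_left huv' hs0).trans_eq (mul_comm _ _))
  have hpe : p = S 0 * (u 0 + v 0) + S 1 * (u 1 + v 1) := by
    simp [hp, PiLp.inner_apply, Fin.sum_univ_two, mul_comm]
  have hκd : κ ^ 2 = 1 - d ^ 2 := by
    have : (u 0 ^ 2 + u 1 ^ 2) * (v 0 ^ 2 + v 1 ^ 2) = 1 := by rw [← hu2, ← hv2]; norm_num
    rw [hκ, hd, cross]
    linear_combination this
  have hdp : 1 / 2 + d = p - s ^ 2 / 2 := by
    rw [hw'] at hw2
    simp only [PiLp.sub_apply] at hw2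
    rw [hpe, hd]
    linear_combination hS2 / 2 - hw2 / 2 + hu2 / 2 + hv2 / 2
  have hχ : spinChirality u v w = 2 / (3 * √3) * (3 * κ + τ) := by
    rw [spinChirality, hw', hκ, hτ]
    simp only [cross, PiLp.sub_apply]
    ring
  have hd1 : |d| ≤ 1 := by
    apply abs_le_of_sq_le_sq _ (by norm_num)
    linarith [sq_nonneg κ, one_pow (M := ℝ) 2]
  -- Both summands contain a factor of order `s`. The bounds below give `7 * s` for the first and
  -- `32 / 9 * s` for the second, whence the constant `11`.
  have hexp : spinChirality u v w ^ 2 - 1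
      = 4 / 3 * ((1 / 2 - d) * (p - s ^ 2 / 2)) + 4 / 27 * ((6 * κ + τ) * τ) := by
    rw [hχ, mul_pow, two_div_three_sqrt_three_sq, ← hdp]
    linear_combination (4 / 3) * hκd
  have hA : |(1 / 2 - d) * (p - s ^ 2 / 2)| ≤ 3 / 2 * (7 / 2 * s) := by
    rw [abs_mul]
    refine mul_le_mul ?_ ?_ (abs_nonneg _) (by norm_num)
    · have := abs_le.mp hd1
      exact abs_le.mpr ⟨by linarith, by linarith⟩
    · have := abs_le.mp hp1
      exact abs_le.mpr ⟨by linarith, by linarith [sq_nonneg s]⟩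
  have hB : |(6 * κ + τ) * τ| ≤ 12 * (2 * s) := by
    rw [abs_mul]
    refine mul_le_mul ?_ hτ1 (abs_nonneg _) (by norm_num)
    have h1 := abs_le.mp hκ1
    have h2 := abs_le.mp hτ1
    exact abs_le.mpr ⟨by linarith, by linarith⟩
  rw [hexp]
  have hA' := abs_le.mp hA
  have hB' := abs_le.mp hB
  exact abs_le.mpr ⟨by linarith, by linarith⟩

/-- Two triples of spins that share two spins have nearly the same chirality where the spins of
both triples nearly cancel. -/
theorem abs_spinChirality_sub_le {u v w w' : Plane} (hu : ‖u‖ = 1) (hv : ‖v‖ = 1) :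
    |spinChirality u v w - spinChirality u v w'| ≤ ‖u + v + w‖ + ‖u + v + w'‖ := by
  -- In the form `3 * κ + τ` the term `κ = cross u v` is common to both triples and cancels.
  have h : spinChirality u v w - spinChirality u v w'
      = 2 / (3 * √3) * cross ((u + v + w) - (u + v + w')) (u - v) := by
    simp only [spinChirality, cross, PiLp.sub_apply, PiLp.add_apply]
    ring
  have huv : ‖u - v‖ ≤ 2 := (norm_sub_le _ _).trans (by linarith)
  have h1 := abs_cross_le ((u + v + w) - (u + v + w')) (u - v)
  have h2 := norm_sub_le (u + v + w) (u + v + w')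
  have h0 : 0 ≤ 2 / (3 * √3) := by positivity
  have h3 := two_div_three_sqrt_three_le
  rw [h, abs_mul, abs_of_nonneg h0]
  calc _ ≤ 1 / 2 * ((‖u + v + w‖ + ‖u + v + w'‖) * 2) := by
        refine mul_le_mul h3 (h1.trans ?_) (abs_nonneg _) (by norm_num)
        exact mul_le_mul h2 huv (norm_nonneg _) (by positivity)
    _ = _ := by ring

theorem abs_signOf_spinChirality_sub_le {u v w : Plane} (hu : ‖u‖ = 1) (hv : ‖v‖ = 1)
    (hw : ‖w‖ = 1) :
    |signOf (spinChirality u v w) - spinChirality u v w| ≤ 11 * ‖u + v + w‖ :=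
  (abs_signOf_sub_le _).trans (abs_spinChirality_sq_sub_one_le hu hv hw)

/-- A linear bound on the difference of two signs improves to a quadratic one. -/
theorem abs_sub_le_of_sign {a b x y z : ℝ} (ha : a = -1 ∨ a = 1) (hb : b = -1 ∨ b = 1)
    (h : |a - b| ≤ 12 * (x + y + z)) : |a - b| ≤ 216 * (x ^ 2 + y ^ 2 + z ^ 2) := by
  -- The difference is `0` or `2`, so it equals half its square; squaring the hypothesis gives `72 *
  -- (x + y + z) ^ 2`, and Cauchy–Schwarz contributes a factor `3`.
  have hd : |a - b| ^ 2 = 2 * |a - b| := by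
    rcases ha with rfl | rfl <;> rcases hb with rfl | rfl <;> norm_num
  have h0 := abs_nonneg (a - b)
  have h1 : |a - b| ^ 2 ≤ (12 * (x + y + z)) ^ 2 := by gcongr
  nlinarith [sq_nonneg (x - y), sq_nonneg (y - z), sq_nonneg (x - z)]

/-! ### Combinatorics of the triangular lattice -/

/-- The lattice point with integer coordinates `a`, `b`. -/
def pt (a b : ℤ) : Plane := (a : ℝ) • e1 + (b : ℝ) • e2

theorem pt_mem_lattice (a b : ℤ) : pt a b ∈ lattice := ⟨a, b, rfl⟩

theorem pt_zero (a b : ℤ) : pt a b 0 = a + b / 2 := by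
  simp [pt, e1, e2]
  ring

theorem pt_one (a b : ℤ) : pt a b 1 = √3 / 2 * b := by
  simp [pt, e1, e2]
  ring

theorem pt_sub (a b c d : ℤ) : pt a b - pt c d = pt (a - c) (b - d) := by
  simp only [pt, Int.cast_sub, sub_smul]
  abel

theorem norm_pt_sq (a b : ℤ) : ‖pt a b‖ ^ 2 = ((a ^ 2 + a * b + b ^ 2 : ℤ) : ℝ) := by
  rw [plane_norm_sq, pt_zero, pt_one, mul_pow, div_pow, Real.sq_sqrt (by norm_num)]
  push_cast
  ring

theorem pt_injective {a b c d : ℤ} (h : pt a b = pt c d) : a = c ∧ b = d := by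
  have h1 : (b : ℝ) = d := by
    have := congrArg (fun x : Plane => x 1) h
    simpa [pt_one] using this
  have h0 : (a : ℝ) = c := by
    have := congrArg (fun x : Plane => x 0) h
    simpa [pt_zero, h1] using this
  exact ⟨by exact_mod_cast h0, by exact_mod_cast h1⟩

theorem norm_pt_eq_one_iff (a b : ℤ) : ‖pt a b‖ = 1 ↔ a ^ 2 + a * b + b ^ 2 = 1 := by
  rw [← sq_eq_sq₀ (norm_nonneg _) zero_le_one, norm_pt_sq, one_pow]
  norm_cast

/-- The first three vectors raise `a - b` by one modulo `3`, the last three lower it by one. The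
sublattices of two neighbours thus decide between the halves. -/
theorem unit_cases {a b : ℤ} (h : ‖pt a b‖ = 1) :
    (a = 1 ∧ b = 0) ∨ (a = 0 ∧ b = -1) ∨ (a = -1 ∧ b = 1) ∨
      (a = -1 ∧ b = 0) ∨ (a = 0 ∧ b = 1) ∨ (a = 1 ∧ b = -1) := by
  rw [norm_pt_eq_one_iff] at h
  have ha : a ≤ 1 := by nlinarith [sq_nonneg (a + 2 * b)]
  have ha' : -1 ≤ a := by nlinarith [sq_nonneg (a + 2 * b)]
  have hb : b ≤ 1 := by nlinarith [sq_nonneg (b + 2 * a)]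
  have hb' : -1 ≤ b := by nlinarith [sq_nonneg (b + 2 * a)]
  interval_cases a <;> interval_cases b <;> simp_all

theorem sublattice1_eq (z₁ z₂ : ℤ) :
    (z₁ : ℝ) • (e1 + e2) + (z₂ : ℝ) • (e2 + e3) = pt (z₁ - z₂) (z₁ + 2 * z₂) := by
  ext m
  fin_cases m
  · simp [pt, e1, e2, e3]
    ring
  · simp [pt, e1, e2, e3]
    ring

theorem pt_add_e1 (a b : ℤ) : pt a b + e1 = pt (a + 1) b := by
  simp only [pt, Int.cast_add, add_smul, Int.cast_one, one_smul]
  abel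

theorem pt_add_e2 (a b : ℤ) : pt a b + e2 = pt a (b + 1) := by
  simp only [pt, Int.cast_add, add_smul, Int.cast_one, one_smul]
  abel

/-- The generators are `pt 1 1` and `pt (-1) 2`, so the three sublattices are the classes of `a - b`
modulo `3`, and membership becomes a question for `omega`. -/
theorem mem_sublattice1_iff {x : Plane} :
    x ∈ sublattice1 ↔ ∃ a b : ℤ, x = pt a b ∧ 3 ∣ a - b := by
  constructor
  · rintro ⟨z₁, z₂, rfl⟩
    exact ⟨_, _, sublattice1_eq z₁ z₂, by omega⟩
  · rintro ⟨a, b, rfl, c, hc⟩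
    refine ⟨a - c, -c, ?_⟩
    rw [sublattice1_eq]
    congr 1 <;> omega

theorem mem_sublattice2_iff {x : Plane} :
    x ∈ sublattice2 ↔ ∃ a b : ℤ, x = pt a b ∧ 3 ∣ a - b - 1 := by
  constructor
  · rintro ⟨y, hy, rfl⟩
    obtain ⟨a, b, rfl, h⟩ := mem_sublattice1_iff.mp hy
    exact ⟨a + 1, b, pt_add_e1 a b, by omega⟩
  · rintro ⟨a, b, rfl, h⟩
    refine ⟨pt (a - 1) b, mem_sublattice1_iff.mpr ⟨_, _, rfl, by omega⟩, ?_⟩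
    rw [pt_add_e1, sub_add_cancel]

theorem mem_sublattice3_iff {x : Plane} :
    x ∈ sublattice3 ↔ ∃ a b : ℤ, x = pt a b ∧ 3 ∣ a - b + 1 := by
  constructor
  · rintro ⟨y, hy, rfl⟩
    obtain ⟨a, b, rfl, h⟩ := mem_sublattice1_iff.mp hy
    exact ⟨a, b + 1, pt_add_e2 a b, by omega⟩
  · rintro ⟨a, b, rfl, h⟩
    refine ⟨pt a (b - 1), mem_sublattice1_iff.mpr ⟨_, _, rfl, by omega⟩, ?_⟩
    rw [pt_add_e2, sub_add_cancel]

/-- `p`, `q`, `r` are the vertices of `T` up to a cyclic rotation of the labels. -/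
def Triangle.HasVertices (T : Triangle) (p q r : Plane) : Prop :=
  (T.i = p ∧ T.j = q ∧ T.k = r) ∨ (T.j = p ∧ T.k = q ∧ T.i = r) ∨ (T.k = p ∧ T.i = q ∧ T.j = r)

/-- `T` is the lower triangle of the lattice cell with lower left corner `pt a b`. -/
def Triangle.IsLower (T : Triangle) (a b : ℤ) : Prop :=
  T.HasVertices (pt a b) (pt (a + 1) b) (pt a (b + 1))

/-- `T` is the upper triangle of the lattice cell with lower left corner `pt a b`. -/
def Triangle.IsUpper (T : Triangle) (a b : ℤ) : Prop :=
  T.HasVertices (pt (a + 1) (b + 1)) (pt (a + 1) b) (pt a (b + 1))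

/-- Seen from `i`, each of `j` and `k` has three possible positions. Of the nine combinations, three
put `j` and `k` on opposite sides of `i`, at distance two; the other six are the triangles around
`i`. -/
theorem Triangle.isLower_or_isUpper (T : Triangle) :
    ∃ a b : ℤ, T.IsLower a b ∨ T.IsUpper a b := by
  obtain ⟨a, b, hi, hi3⟩ := mem_sublattice1_iff.mp T.i_mem1
  obtain ⟨c, d, hj, hj3⟩ := mem_sublattice2_iff.mp T.j_mem2
  obtain ⟨e, f, hk, hk3⟩ := mem_sublattice3_iff.mp T.k_mem3
  have hij := T.dist_ij
  have hjk := T.dist_jk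
  have hki := T.dist_ki
  rw [hi, hj, norm_sub_rev, pt_sub] at hij
  rw [hj, hk, pt_sub] at hjk
  rw [hk, hi, pt_sub] at hki
  have h1 : (c = a + 1 ∧ d = b) ∨ (c = a ∧ d = b - 1) ∨ (c = a - 1 ∧ d = b + 1) := by
    have := unit_cases hij
    omega
  have h2 : (e = a - 1 ∧ f = b) ∨ (e = a ∧ f = b + 1) ∨ (e = a + 1 ∧ f = b - 1) := by
    have := unit_cases hki
    omega
  have h3 := unit_cases hjk
  unfold Triangle.IsLower Triangle.IsUpper Triangle.HasVertices
  rw [hi, hj, hk]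
  clear hi hj hk hij hjk hki
  rcases h1 with ⟨hc, hd⟩ | ⟨hc, hd⟩ | ⟨hc, hd⟩ <;>
    rcases h2 with ⟨he, hf⟩ | ⟨he, hf⟩ | ⟨he, hf⟩ <;> subst c d e f
  · omega
  · exact ⟨a, b, by simp⟩
  · exact ⟨a, b - 1, by simp⟩
  · exact ⟨a - 1, b - 1, by simp⟩
  · omega
  · exact ⟨a, b - 1, by simp⟩
  · exact ⟨a - 1, b, by simp⟩
  · exact ⟨a - 1, b, by simp⟩
  · omega

/-- The disjunction lists the three cyclic assignments of sublattices to the vertices; the residue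
of the first vertex selects which one is the vertex `i`. -/
theorem exists_triangle_hasVertices {a b c d e f : ℤ}
    (h : (3 ∣ a - b ∧ 3 ∣ c - d - 1 ∧ 3 ∣ e - f + 1) ∨
      (3 ∣ a - b - 1 ∧ 3 ∣ c - d + 1 ∧ 3 ∣ e - f) ∨ (3 ∣ a - b + 1 ∧ 3 ∣ c - d ∧ 3 ∣ e - f - 1))
    (h1 : ‖pt a b - pt c d‖ = 1) (h2 : ‖pt c d - pt e f‖ = 1) (h3 : ‖pt e f - pt a b‖ = 1) :
    ∃ T : Triangle, T.HasVertices (pt a b) (pt c d) (pt e f) := by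
  rcases h with ⟨ha, hc, he⟩ | ⟨ha, hc, he⟩ | ⟨ha, hc, he⟩
  · exact ⟨⟨pt a b, pt c d, pt e f, pt_mem_lattice _ _, pt_mem_lattice _ _, pt_mem_lattice _ _,
      mem_sublattice1_iff.mpr ⟨_, _, rfl, ha⟩, mem_sublattice2_iff.mpr ⟨_, _, rfl, hc⟩,
      mem_sublattice3_iff.mpr ⟨_, _, rfl, he⟩, h1, h2, h3⟩, Or.inl ⟨rfl, rfl, rfl⟩⟩
  · exact ⟨⟨pt e f, pt a b, pt c d, pt_mem_lattice _ _, pt_mem_lattice _ _, pt_mem_lattice _ _,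
      mem_sublattice1_iff.mpr ⟨_, _, rfl, he⟩, mem_sublattice2_iff.mpr ⟨_, _, rfl, ha⟩,
      mem_sublattice3_iff.mpr ⟨_, _, rfl, hc⟩, h3, h1, h2⟩, Or.inr (Or.inl ⟨rfl, rfl, rfl⟩)⟩
  · exact ⟨⟨pt c d, pt e f, pt a b, pt_mem_lattice _ _, pt_mem_lattice _ _, pt_mem_lattice _ _,
      mem_sublattice1_iff.mpr ⟨_, _, rfl, hc⟩, mem_sublattice2_iff.mpr ⟨_, _, rfl, he⟩,
      mem_sublattice3_iff.mpr ⟨_, _, rfl, ha⟩, h2, h3, h1⟩, Or.inr (Or.inr ⟨rfl, rfl, rfl⟩)⟩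

theorem exists_isLower (a b : ℤ) : ∃ T : Triangle, T.IsLower a b := by
  apply exists_triangle_hasVertices
  · omega
  all_goals
    rw [pt_sub]
    exact (norm_pt_eq_one_iff _ _).mpr (by ring)

theorem exists_isUpper (a b : ℤ) : ∃ T : Triangle, T.IsUpper a b := by
  apply exists_triangle_hasVertices
  · omega
  all_goals
    rw [pt_sub]
    exact (norm_pt_eq_one_iff _ _).mpr (by ring)

theorem Triangle.HasVertices.carrier_eq {T : Triangle} {p q r : Plane}
    (h : T.HasVertices p q r) (ε : ℝ) :
    T.carrier ε = convexHull ℝ {ε • p, ε • q, ε • r} := by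
  unfold Triangle.carrier
  congr 1
  ext x
  simp only [Set.mem_insert_iff, Set.mem_singleton_iff]
  rcases h with ⟨h1, h2, h3⟩ | ⟨h1, h2, h3⟩ | ⟨h1, h2, h3⟩ <;> rw [h1, h2, h3]
  · tauto
  · tauto

theorem Triangle.HasVertices.add_eq {T : Triangle} {p q r : Plane} (h : T.HasVertices p q r) :
    T.i + T.j + T.k = p + q + r := by
  rcases h with ⟨h1, h2, h3⟩ | ⟨h1, h2, h3⟩ | ⟨h1, h2, h3⟩ <;> rw [h1, h2, h3]
  · abel
  · abel

/-- The vertex sum does not depend on the rotation of the labels and determines the cell; the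
injectivity of the families of triangles rests on this. -/
theorem Triangle.IsLower.add_eq {T : Triangle} {a b : ℤ} (h : T.IsLower a b) :
    T.i + T.j + T.k = pt (3 * a + 1) (3 * b + 1) := by
  rw [Triangle.HasVertices.add_eq h]
  simp only [pt]
  push_cast
  module

theorem Triangle.IsUpper.add_eq {T : Triangle} {a b : ℤ} (h : T.IsUpper a b) :
    T.i + T.j + T.k = pt (3 * a + 2) (3 * b + 2) := by
  rw [Triangle.HasVertices.add_eq h]
  simp only [pt]
  push_cast
  module

/-! ### Chirality and sign jumps on the cells of the lattice -/

section Spins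

variable {ε : ℝ}

/-- The spin at the lattice point with integer coordinates `a`, `b`. -/
def spinAt (u : SpinField ε) (a b : ℤ) : Plane :=
  u ⟨ε • pt a b, Set.smul_mem_smul_set (pt_mem_lattice a b)⟩

theorem norm_spinAt (u : SpinField ε) (a b : ℤ) : ‖spinAt u a b‖ = 1 :=
  norm_eq_of_mem_sphere _

/-- The sum of the spins on the lower triangle of a cell. -/
def lowerSum (u : SpinField ε) (a b : ℤ) : Plane :=
  spinAt u a b + spinAt u (a + 1) b + spinAt u a (b + 1)

/-- The sum of the spins on the upper triangle of a cell. -/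
def upperSum (u : SpinField ε) (a b : ℤ) : Plane :=
  spinAt u (a + 1) (b + 1) + spinAt u (a + 1) b + spinAt u a (b + 1)

/-- The chirality of the lower triangle of a cell. -/
def lowerChirality (u : SpinField ε) (a b : ℤ) : ℝ :=
  spinChirality (spinAt u a b) (spinAt u (a + 1) b) (spinAt u a (b + 1))

/-- The chirality of the upper triangle of a cell. -/
def upperChirality (u : SpinField ε) (a b : ℤ) : ℝ :=
  spinChirality (spinAt u (a + 1) (b + 1)) (spinAt u (a + 1) b) (spinAt u a (b + 1))

/-- The excess of a cell. -/
def cellExcess (u : SpinField ε) (a b : ℤ) : ℝ :=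
  ‖lowerSum u a b‖ ^ 2 + ‖upperSum u a b‖ ^ 2

/-- The sign of the chirality of the lower triangle of a cell. -/
def cellSign (u : SpinField ε) (a b : ℤ) : ℝ := signOf (lowerChirality u a b)

theorem cellExcess_nonneg (u : SpinField ε) (a b : ℤ) : 0 ≤ cellExcess u a b := by
  unfold cellExcess
  positivity

theorem spinI_eq (u : SpinField ε) {T : Triangle} {a b : ℤ} (h : T.i = pt a b) :
    spinI u T = spinAt u a b := by
  unfold spinI spinAt
  simp only [h]

theorem spinJ_eq (u : SpinField ε) {T : Triangle} {a b : ℤ} (h : T.j = pt a b) :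
    spinJ u T = spinAt u a b := by
  unfold spinJ spinAt
  simp only [h]

theorem spinK_eq (u : SpinField ε) {T : Triangle} {a b : ℤ} (h : T.k = pt a b) :
    spinK u T = spinAt u a b := by
  unfold spinK spinAt
  simp only [h]

theorem Triangle.HasVertices.spin_add_eq {T : Triangle} {a b c d e f : ℤ}
    (h : T.HasVertices (pt a b) (pt c d) (pt e f)) (u : SpinField ε) :
    spinI u T + spinJ u T + spinK u T = spinAt u a b + spinAt u c d + spinAt u e f := by
  rcases h with ⟨h1, h2, h3⟩ | ⟨h1, h2, h3⟩ | ⟨h1, h2, h3⟩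
  · rw [spinI_eq u h1, spinJ_eq u h2, spinK_eq u h3]
  · rw [spinJ_eq u h1, spinK_eq u h2, spinI_eq u h3]
    abel
  · rw [spinK_eq u h1, spinI_eq u h2, spinJ_eq u h3]
    abel

theorem Triangle.HasVertices.chirality_eq {T : Triangle} {a b c d e f : ℤ}
    (h : T.HasVertices (pt a b) (pt c d) (pt e f)) (u : SpinField ε) :
    triangleChirality u T = spinChirality (spinAt u a b) (spinAt u c d) (spinAt u e f) := by
  change spinChirality (spinI u T) (spinJ u T) (spinK u T) = _
  rcases h with ⟨h1, h2, h3⟩ | ⟨h1, h2, h3⟩ | ⟨h1, h2, h3⟩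
  · rw [spinI_eq u h1, spinJ_eq u h2, spinK_eq u h3]
  · rw [spinJ_eq u h1, spinK_eq u h2, spinI_eq u h3]
    exact (spinChirality_rotate _ _ _).symm
  · rw [spinK_eq u h1, spinI_eq u h2, spinJ_eq u h3]
    exact spinChirality_rotate _ _ _

theorem Triangle.IsLower.energy_eq {T : Triangle} {a b : ℤ} (h : T.IsLower a b)
    (u : SpinField ε) : triangleEnergy u T = ε * ‖lowerSum u a b‖ ^ 2 := by
  rw [triangleEnergy, Triangle.HasVertices.spin_add_eq h, lowerSum]

theorem Triangle.IsUpper.energy_eq {T : Triangle} {a b : ℤ} (h : T.IsUpper a b)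
    (u : SpinField ε) : triangleEnergy u T = ε * ‖upperSum u a b‖ ^ 2 := by
  rw [triangleEnergy, Triangle.HasVertices.spin_add_eq h, upperSum]

theorem abs_lowerChirality_le (u : SpinField ε) (a b : ℤ) : |lowerChirality u a b| ≤ 2 :=
  abs_spinChirality_le (norm_spinAt _ _ _) (norm_spinAt _ _ _) (norm_spinAt _ _ _)

theorem abs_upperChirality_le (u : SpinField ε) (a b : ℤ) : |upperChirality u a b| ≤ 2 :=
  abs_spinChirality_le (norm_spinAt _ _ _) (norm_spinAt _ _ _) (norm_spinAt _ _ _)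

theorem abs_cellSign (u : SpinField ε) (a b : ℤ) : |cellSign u a b| = 1 := abs_signOf _

theorem abs_lowerChirality_sub_cellSign_le (u : SpinField ε) (a b : ℤ) :
    |lowerChirality u a b - cellSign u a b| ≤ 11 * ‖lowerSum u a b‖ := by
  rw [abs_sub_comm]
  exact abs_signOf_spinChirality_sub_le (norm_spinAt _ _ _) (norm_spinAt _ _ _) (norm_spinAt _ _ _)

/-- Both triangles contain the diagonal of the cell in the same cyclic order, so they differ in one
spin only. The two lemmas that follow use the common side with the right and with the top neighbour
in the same way. -/
theorem abs_upperChirality_sub_lowerChirality_le (u : SpinField ε) (a b : ℤ) :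
    |upperChirality u a b - lowerChirality u a b| ≤ ‖upperSum u a b‖ + ‖lowerSum u a b‖ := by
  have h := abs_spinChirality_sub_le (w := spinAt u (a + 1) (b + 1)) (w' := spinAt u a b)
    (norm_spinAt u (a + 1) b) (norm_spinAt u a (b + 1))
  rw [spinChirality_rotate (spinAt u (a + 1) (b + 1)), spinChirality_rotate (spinAt u a b),
    add_comm _ (spinAt u (a + 1) (b + 1)), add_comm _ (spinAt u a b), ← add_assoc,
    ← add_assoc] at h
  exact h

theorem abs_lowerChirality_right_sub_le (u : SpinField ε) (a b : ℤ) :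
    |lowerChirality u (a + 1) b - upperChirality u a b|
      ≤ ‖lowerSum u (a + 1) b‖ + ‖upperSum u a b‖ := by
  have h := abs_spinChirality_sub_le (w := spinAt u (a + 1 + 1) b) (w' := spinAt u a (b + 1))
    (norm_spinAt u (a + 1) (b + 1)) (norm_spinAt u (a + 1) b)
  have hs : spinAt u (a + 1) (b + 1) + spinAt u (a + 1) b + spinAt u (a + 1 + 1) b
      = lowerSum u (a + 1) b := by
    unfold lowerSum
    abel
  rw [← spinChirality_rotate _ _ (spinAt u (a + 1 + 1) b), hs] at h
  exact h

theorem abs_lowerChirality_top_sub_le (u : SpinField ε) (a b : ℤ) :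
    |lowerChirality u a (b + 1) - upperChirality u a b|
      ≤ ‖lowerSum u a (b + 1)‖ + ‖upperSum u a b‖ := by
  have h := abs_spinChirality_sub_le (w := spinAt u a (b + 1 + 1)) (w' := spinAt u (a + 1) b)
    (norm_spinAt u a (b + 1)) (norm_spinAt u (a + 1) (b + 1))
  have hs : spinAt u a (b + 1) + spinAt u (a + 1) (b + 1) + spinAt u (a + 1) b
      = upperSum u a b := by
    unfold upperSum
    abel
  rw [← spinChirality_rotate _ _ (spinAt u (a + 1) b), hs] at h
  exact h

theorem abs_upperChirality_sub_cellSign_le (u : SpinField ε) (a b : ℤ) :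
    |upperChirality u a b - cellSign u a b| ≤ 12 * ‖lowerSum u a b‖ + ‖upperSum u a b‖ := by
  have h1 := abs_upperChirality_sub_lowerChirality_le u a b
  have h2 := abs_lowerChirality_sub_cellSign_le u a b
  have h3 := abs_sub_le (upperChirality u a b) (lowerChirality u a b) (cellSign u a b)
  linarith

/-- Jumps of the sign between horizontally adjacent cells are controlled by the excess. -/
theorem abs_cellSign_right_sub_le (u : SpinField ε) (a b : ℤ) :
    |cellSign u (a + 1) b - cellSign u a b|
      ≤ 216 * (cellExcess u a b + cellExcess u (a + 1) b) := by
  have h1 := abs_upperChirality_sub_cellSign_le u a b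
  have h2 := abs_lowerChirality_sub_cellSign_le u (a + 1) b
  have h3 := abs_lowerChirality_right_sub_le u a b
  -- The path from sign to sign through the chiralities of the triangles in between costs `11 * z`,
  -- then `z + y`, then `12 * x + y`, at most `12 * (x + y + z)` in total.
  have h := abs_sub_le_of_sign (x := ‖lowerSum u a b‖) (y := ‖upperSum u a b‖)
    (z := ‖lowerSum u (a + 1) b‖) (signOf_eq (lowerChirality u (a + 1) b))
    (signOf_eq (lowerChirality u a b)) (by
      rw [abs_sub_comm] at h2
      have h4 := abs_sub_le (cellSign u (a + 1) b) (lowerChirality u (a + 1) b) (cellSign u a b)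
      have h5 := abs_sub_le (lowerChirality u (a + 1) b) (upperChirality u a b) (cellSign u a b)
      have := norm_nonneg (upperSum u a b)
      change |cellSign u (a + 1) b - cellSign u a b| ≤ _
      linarith)
  refine h.trans ?_
  unfold cellExcess
  nlinarith [sq_nonneg ‖upperSum u (a + 1) b‖]

/-- Jumps of the sign between vertically adjacent cells are controlled by the excess. -/
theorem abs_cellSign_top_sub_le (u : SpinField ε) (a b : ℤ) :
    |cellSign u a (b + 1) - cellSign u a b|
      ≤ 216 * (cellExcess u a b + cellExcess u a (b + 1)) := by
  have h1 := abs_upperChirality_sub_cellSign_le u a b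
  have h2 := abs_lowerChirality_sub_cellSign_le u a (b + 1)
  have h3 := abs_lowerChirality_top_sub_le u a b
  have h := abs_sub_le_of_sign (x := ‖lowerSum u a b‖) (y := ‖upperSum u a b‖)
    (z := ‖lowerSum u a (b + 1)‖) (signOf_eq (lowerChirality u a (b + 1)))
    (signOf_eq (lowerChirality u a b)) (by
      rw [abs_sub_comm] at h2
      have h4 := abs_sub_le (cellSign u a (b + 1)) (lowerChirality u a (b + 1)) (cellSign u a b)
      have h5 := abs_sub_le (lowerChirality u a (b + 1)) (upperChirality u a b) (cellSign u a b)
      have := norm_nonneg (upperSum u a b)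
      change |cellSign u a (b + 1) - cellSign u a b| ≤ _
      linarith)
  refine h.trans ?_
  unfold cellExcess
  nlinarith [sq_nonneg ‖upperSum u a (b + 1)‖]

end Spins

/-! ### A Kolmogorov–Riesz compactness criterion -/

/-- Bounded sequences of measurable functions on a finite measure space have weakly convergent
subsequences. -/
theorem exists_subseq_tendsto_setIntegral {α : Type*} [MeasurableSpace α]
    [MeasurableSpace.CountablyGenerated α] (μ : Measure α) [IsFiniteMeasure μ]
    (f : ℕ → α → ℝ) (hf : ∀ n, Measurable (f n)) (hb : ∀ n x, |f n x| ≤ 1) :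
    ∃ s : ℕ → ℕ, StrictMono s ∧ ∀ A, MeasurableSet A →
      ∃ l : ℝ, Tendsto (fun n => ∫ x in A, f (s n) x ∂μ) atTop (𝓝 l) := by
  have : Fact ((2 : ℝ≥0∞) ≠ ∞) := ⟨by simp⟩
  have hmem (n : ℕ) : MemLp (f n) 2 μ :=
    MemLp.of_bound (hf n).aestronglyMeasurable 1 (ae_of_all _ fun x => hb n x)
  -- As functionals on the separable space `L²`, the functions stay in a fixed ball, which is
  -- sequentially weak-* compact. Testing the limit against indicators gives the claim.
  let F : ℕ → WeakDual ℝ (Lp ℝ 2 μ) := fun n =>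
    StrongDual.toWeakDual (innerSL ℝ ((hmem n).toLp (f n)))
  obtain ⟨C, hC⟩ : ∃ C : ℝ, ∀ n, ‖(hmem n).toLp (f n)‖ ≤ C := by
    refine ⟨_, fun n => Lp.norm_le_of_ae_bound (C := 1) zero_le_one ?_⟩
    filter_upwards [(hmem n).coeFn_toLp] with x hx
    rw [hx]
    exact hb n x
  have hF (n : ℕ) : F n ∈ WeakDual.toStrongDual ⁻¹' Metric.closedBall
      (0 : StrongDual ℝ (Lp ℝ 2 μ)) C := by
    simp only [Set.mem_preimage, mem_closedBall_zero_iff]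
    exact (innerSL_apply_norm ℝ _).trans_le (hC n)
  obtain ⟨l, -, s, hs, hl⟩ := WeakDual.isSeqCompact_closedBall ℝ (Lp ℝ 2 μ) 0 C hF
  refine ⟨s, hs, fun A hA => ⟨l (indicatorConstLp 2 hA (measure_ne_top μ A) 1), ?_⟩⟩
  have h := (WeakDual.eval_continuous (indicatorConstLp 2 hA (measure_ne_top μ A) (1 : ℝ))).tendsto
    l |>.comp hl
  refine h.congr fun n => ?_
  change inner ℝ ((hmem (s n)).toLp (f (s n))) (indicatorConstLp 2 hA (measure_ne_top μ A) (1 : ℝ))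
    = _
  rw [real_inner_comm, L2.inner_indicatorConstLp_one]
  exact setIntegral_congr_ae hA ((hmem (s n)).coeFn_toLp.mono fun x hx _ => hx)

/-- The average of `g` over the translate of `B` by `x`. -/
def translateAverage (B : Set Plane) (g : Plane → ℝ) (x : Plane) : ℝ :=
  ∫ h, g (x + h) ∂((volume B)⁻¹ • volume.restrict B)

/-- Away from the boundary the average is a fixed multiple of an integral over a subset of `Ω`. Weak
convergence therefore makes the averages converge at each such point. -/
theorem translateAverage_eq {B Ω : Set Plane} (hB : MeasurableSet B)
    {x : Plane} (hx : ∀ h ∈ B, x + h ∈ Ω) (g : Plane → ℝ) :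
    translateAverage B g x = ((volume B)⁻¹).toReal *
      ∫ y in (fun y => y - x) ⁻¹' B, g y ∂(volume.restrict Ω) := by
  have hA : MeasurableSet ((fun y => y - x) ⁻¹' B) := (measurable_id.sub_const x) hB
  have hsub : (fun y => y - x) ⁻¹' B ⊆ Ω := fun y hy => by simpa using hx _ hy
  have hpre : (fun h => x + h) ⁻¹' ((fun y => y - x) ⁻¹' B) = B := by
    ext h
    simp
  rw [translateAverage, integral_smul_measure, smul_eq_mul, Measure.restrict_restrict hA,
    Set.inter_eq_left.mpr hsub]
  have := (measurePreserving_add_left (volume : Measure Plane) x).setIntegral_preimage_emb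
    (measurableEmbedding_addLeft x) g ((fun y => y - x) ⁻¹' B)
  rw [hpre] at this
  rw [this]

theorem measurable_translateAverage {B : Set Plane} (hB0 : volume B ≠ 0) {g : Plane → ℝ}
    (hg : Measurable g) : Measurable (translateAverage B g) := by
  have : SFinite ((volume B)⁻¹ • (volume : Measure Plane).restrict B) := by
    lift (volume B)⁻¹ to NNReal using ENNReal.inv_ne_top.mpr hB0 with c
    infer_instance
  have h : StronglyMeasurable (Function.uncurry fun x h : Plane => g (x + h)) :=
    (hg.comp (measurable_fst.add measurable_snd)).stronglyMeasurable
  exact h.integral_prod_right.measurable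

theorem isProbabilityMeasure_normalized {B : Set Plane} (hB0 : volume B ≠ 0)
    (hB : volume B ≠ ⊤) :
    IsProbabilityMeasure ((volume B)⁻¹ • (volume : Measure Plane).restrict B) :=
  ⟨by simp [ENNReal.inv_mul_cancel hB0 hB]⟩

theorem enorm_translateAverage_le {B : Set Plane} (hB0 : volume B ≠ 0) (hB : volume B ≠ ⊤)
    {g : Plane → ℝ} (hb : ∀ x, |g x| ≤ 1) (x : Plane) : ‖translateAverage B g x‖ₑ ≤ 1 := by
  have := isProbabilityMeasure_normalized hB0 hB
  refine (enorm_integral_le_lintegral_enorm _).trans ?_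
  calc _ ≤ ∫⁻ _, 1 ∂((volume B)⁻¹ • (volume : Measure Plane).restrict B) := by
        refine lintegral_mono fun h => ?_
        rw [← ofReal_norm, ← ENNReal.ofReal_one]
        exact ENNReal.ofReal_le_ofReal (hb _)
    _ = 1 := by simp

/-- Translation estimates control the distance to the averages. -/
theorem lintegral_translateAverage_sub_le {B K : Set Plane} (hBm : MeasurableSet B)
    (hB0 : volume B ≠ 0) (hB : volume B ≠ ⊤) {g : Plane → ℝ} (hg : Measurable g)
    (hb : ∀ x, |g x| ≤ 1) {η : ℝ≥0∞}
    (H : ∀ h ∈ B, ∫⁻ x in K, ‖g (x + h) - g x‖ₑ ≤ η) :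
    ∫⁻ x in K, ‖translateAverage B g x - g x‖ₑ ≤ η := by
  have := isProbabilityMeasure_normalized hB0 hB
  set ν := (volume B)⁻¹ • (volume : Measure Plane).restrict B with hν
  have hae : ∀ᵐ h ∂ν, h ∈ B := by
    rw [hν, Measure.ae_ennreal_smul_measure_iff (ENNReal.inv_ne_zero.mpr hB)]
    exact ae_restrict_mem hBm
  calc ∫⁻ x in K, ‖translateAverage B g x - g x‖ₑ
      ≤ ∫⁻ x in K, ∫⁻ h, ‖g (x + h) - g x‖ₑ ∂ν := by
        refine lintegral_mono fun x => ?_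
        have hint : Integrable (fun h => g (x + h)) ν :=
          Integrable.of_bound (hg.comp (measurable_const_add x)).aestronglyMeasurable 1
            (ae_of_all _ fun h => hb _)
        have : translateAverage B g x - g x = ∫ h, (g (x + h) - g x) ∂ν := by
          rw [integral_sub hint (integrable_const _)]
          simp [translateAverage, hν]
        simp only [this]
        exact enorm_integral_le_lintegral_enorm _
    _ = ∫⁻ h, (∫⁻ x in K, ‖g (x + h) - g x‖ₑ) ∂ν := by
        refine lintegral_lintegral_swap ?_
        exact (((hg.comp (measurable_fst.add measurable_snd)).sub
          (hg.comp measurable_fst)).enorm).aemeasurable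
    _ ≤ ∫⁻ _, η ∂ν := lintegral_mono_ae (hae.mono fun h hh => H h hh)
    _ = η := by simp

/-- A compactness criterion in `L¹` of an open set of finite measure for bounded sequences with
uniformly small translation differences in the interior. -/
theorem exists_subseq_tendsto_of_translate {Ω : Set Plane} (hΩ : IsOpen Ω)
    (hfin : volume Ω ≠ ⊤) {f : ℕ → Plane → ℝ} (hf : ∀ n, Measurable (f n))
    (hb : ∀ n x, |f n x| ≤ 1)
    (H : ∀ K, IsCompact K → K ⊆ Ω → ∀ η : ℝ≥0∞, 0 < η → ∃ B : Set Plane,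
      MeasurableSet B ∧ volume B ≠ 0 ∧ volume B ≠ ⊤ ∧ (∀ x ∈ K, ∀ h ∈ B, x + h ∈ Ω) ∧
      ∀ᶠ n in atTop, ∀ h ∈ B, ∫⁻ x in K, ‖f n (x + h) - f n x‖ₑ ≤ η) :
    ∃ s : ℕ → ℕ, StrictMono s ∧ ∃ χ : Plane → ℝ, MemLp χ 1 (volume.restrict Ω) ∧
      Tendsto (fun n => eLpNorm (fun x => f (s n) x - χ x) 1 (volume.restrict Ω))
        atTop (𝓝 0) := by
  have : IsFiniteMeasure ((volume : Measure Plane).restrict Ω) := ⟨by simpa using hfin.lt_top⟩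
  have hmem (n : ℕ) : MemLp (f n) 1 (volume.restrict Ω) :=
    MemLp.of_bound (hf n).aestronglyMeasurable 1 (ae_of_all _ fun x => hb n x)
  obtain ⟨s, hs, hweak⟩ := exists_subseq_tendsto_setIntegral (volume.restrict Ω) f hf hb
  have hcauchy : CauchySeq fun n => (hmem (s n)).toLp (f (s n)) := by
    rw [EMetric.cauchySeq_iff]
    intro r hr
    -- The factor `6` is `2` from `Ω \ K`, where two functions bounded by one are compared, plus `2`
    -- for each of the two functions on `K`.
    obtain ⟨η, hη0, hη⟩ := ENNReal.exists_nnreal_pos_mul_lt (a := 6) (by simp) hr.ne'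
    have hη0' : (0 : ℝ≥0∞) < η := by exact_mod_cast hη0
    obtain ⟨K, hKΩ, hK, hKη⟩ := hΩ.measurableSet.exists_isCompact_sdiff_lt hfin hη0'.ne'
    obtain ⟨B, hBm, hB0, hB, hBΩ, hBη⟩ := H K hK hKΩ η hη0'
    have hlim : ∀ x ∈ K, ∃ l, Tendsto (fun n => translateAverage B (f (s n)) x) atTop (𝓝 l) := by
      intro x hx
      obtain ⟨l, hl⟩ := hweak ((fun y => y - x) ⁻¹' B) ((measurable_id.sub_const x) hBm)
      refine ⟨((volume B)⁻¹).toReal * l, ?_⟩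
      simp only [translateAverage_eq hBm (hBΩ x hx)]
      exact hl.const_mul _
    -- On `K` every late function is close to its average, and the averages converge to `m`. The
    -- values of `m` off `K` play no role.
    choose! m hm using hlim
    have hmae : ∀ᵐ x ∂(volume.restrict K),
        Tendsto (fun n => translateAverage B (f (s n)) x) atTop (𝓝 (m x)) :=
      (ae_restrict_mem hK.measurableSet).mono hm
    have hmeas (n : ℕ) := measurable_translateAverage hB0 (hf (s n))
    have hmm : AEMeasurable m (volume.restrict K) :=
      aemeasurable_of_tendsto_metrizable_ae atTop (fun n => (hmeas n).aemeasurable) hmae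
    have havg : Tendsto (fun n => ∫⁻ x in K, ‖translateAverage B (f (s n)) x - m x‖ₑ)
        atTop (𝓝 0) := by
      rw [← lintegral_zero (μ := volume.restrict K)]
      refine tendsto_lintegral_of_dominated_convergence' (fun _ => 2)
        (fun n => ((hmeas n).aemeasurable.sub hmm).enorm) (fun n => ?_) ?_ ?_
      · filter_upwards [hmae] with x hx
        have h1 (n : ℕ) := enorm_translateAverage_le hB0 hB (hb (s n)) x
        have h2 : ‖m x‖ₑ ≤ 1 := le_of_tendsto' hx.enorm h1
        calc _ ≤ ‖translateAverage B (f (s n)) x‖ₑ + ‖m x‖ₑ := enorm_sub_le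
          _ ≤ 1 + 1 := add_le_add (h1 n) h2
          _ = 2 := by norm_num
      · simpa using ENNReal.mul_ne_top (by simp) hK.measure_ne_top
      · filter_upwards [hmae] with x hx
        simpa using (hx.sub_const (m x)).enorm
    obtain ⟨N, hN⟩ := ((hs.tendsto_atTop.eventually hBη).and
      (havg.eventually (gt_mem_nhds hη0'))).exists_forall_of_atTop
    refine ⟨N, fun i hi j hj => ?_⟩
    rw [Lp.edist_toLp_toLp, eLpNorm_one_eq_lintegral_enorm]
    refine lt_of_le_of_lt ?_ hη
    have hclose (n : ℕ) (hn : N ≤ n) : ∫⁻ x in K, ‖f (s n) x - m x‖ₑ ≤ 2 * η := by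
      calc ∫⁻ x in K, ‖f (s n) x - m x‖ₑ
          ≤ ∫⁻ x in K, (‖translateAverage B (f (s n)) x - f (s n) x‖ₑ
              + ‖translateAverage B (f (s n)) x - m x‖ₑ) := by
            refine lintegral_mono fun x => ?_
            have : f (s n) x - m x = (translateAverage B (f (s n)) x - m x)
              - (translateAverage B (f (s n)) x - f (s n) x) := by ring
            rw [this, add_comm]
            exact enorm_sub_le
        _ = _ := lintegral_add_left ((hmeas n).sub (hf (s n))).enorm _
        _ ≤ η + η := add_le_add (lintegral_translateAverage_sub_le hBm hB0 hB (hf _) (hb _)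
              (hN n hn).1) (hN n hn).2.le
        _ = 2 * η := (two_mul _).symm
    have hsplit : Ω = (Ω \ K) ∪ K := (Set.sdiff_union_of_subset hKΩ).symm
    calc ∫⁻ x in Ω, ‖(f (s i) - f (s j)) x‖ₑ
        ≤ (∫⁻ x in Ω \ K, ‖(f (s i) - f (s j)) x‖ₑ) + ∫⁻ x in K, ‖(f (s i) - f (s j)) x‖ₑ := by
          conv_lhs => rw [hsplit]
          exact lintegral_union_le _ _ _
      _ ≤ (∫⁻ _ in Ω \ K, 2) + ∫⁻ x in K, (‖f (s i) x - m x‖ₑ + ‖f (s j) x - m x‖ₑ) := by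
          refine add_le_add (lintegral_mono fun x => ?_) (lintegral_mono fun x => ?_)
          · have h1 (n : ℕ) : ‖f n x‖ₑ ≤ 1 := by
              rw [← ofReal_norm, ← ENNReal.ofReal_one]
              exact ENNReal.ofReal_le_ofReal (hb n x)
            calc _ ≤ ‖f (s i) x‖ₑ + ‖f (s j) x‖ₑ := enorm_sub_le
              _ ≤ 1 + 1 := add_le_add (h1 _) (h1 _)
              _ = 2 := by norm_num
          · have : (f (s i) - f (s j)) x = (f (s i) x - m x) - (f (s j) x - m x) := by
              simp
            rw [this]
            exact enorm_sub_le
      _ = 2 * volume (Ω \ K) + ((∫⁻ x in K, ‖f (s i) x - m x‖ₑ)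
          + ∫⁻ x in K, ‖f (s j) x - m x‖ₑ) := by
          have hsum := lintegral_add_left' ((hf (s i)).aemeasurable.sub hmm).enorm
            (fun x => ‖f (s j) x - m x‖ₑ)
          simp only [Pi.sub_apply] at hsum
          rw [hsum]
          simp
      _ ≤ 2 * η + (2 * η + 2 * η) := by
          gcongr
          · exact hclose i hi
          · exact hclose j hj
      _ = η * 6 := by ring
  obtain ⟨g, hg⟩ := cauchySeq_tendsto_of_complete hcauchy
  refine ⟨s, hs, g, Lp.memLp g, ?_⟩
  rw [Lp.tendsto_Lp_iff_tendsto_eLpNorm'] at hg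
  refine hg.congr fun n => eLpNorm_congr_ae ?_
  filter_upwards [(hmem (s n)).coeFn_toLp] with x hx
  simp [hx]

/-! ### Lattice coordinates, cells and interiors of triangles -/

/-- The first coordinate with respect to the basis `e1`, `e2`. -/
def coord1 : Plane →L[ℝ] ℝ :=
  EuclideanSpace.proj (0 : Fin 2) - (√3)⁻¹ • EuclideanSpace.proj (1 : Fin 2)

/-- The second coordinate with respect to the basis `e1`, `e2`. -/
def coord2 : Plane →L[ℝ] ℝ := (2 * (√3)⁻¹) • EuclideanSpace.proj (1 : Fin 2)

theorem coord1_apply (x : Plane) : coord1 x = x 0 - (√3)⁻¹ * x 1 := by simp [coord1]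

theorem coord2_apply (x : Plane) : coord2 x = 2 * (√3)⁻¹ * x 1 := by simp [coord2]

@[simp] theorem coord1_e1 : coord1 e1 = 1 := by simp [coord1_apply, e1]

@[simp] theorem coord2_e1 : coord2 e1 = 0 := by simp [coord2_apply, e1]

@[simp] theorem coord1_e2 : coord1 e2 = 0 := by
  have : √3 ≠ 0 := by positivity
  simp only [coord1_apply, e2, Matrix.cons_val_zero, Matrix.cons_val_one]
  field_simp
  ring

@[simp] theorem coord2_e2 : coord2 e2 = 1 := by
  have : √3 ≠ 0 := by positivity
  simp only [coord2_apply, e2, Matrix.cons_val_one, Matrix.cons_val_zero]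
  field_simp

theorem eq_coord (x : Plane) : x = coord1 x • e1 + coord2 x • e2 := by
  have : √3 ≠ 0 := by positivity
  ext m
  fin_cases m
  · simp [coord1_apply, coord2_apply, e1, e2]
    ring
  · simp [coord1_apply, coord2_apply, e1, e2]
    field_simp

@[simp] theorem coord1_pt (a b : ℤ) : coord1 (pt a b) = a := by simp [pt]

@[simp] theorem coord2_pt (a b : ℤ) : coord2 (pt a b) = b := by simp [pt]

theorem norm_e1 : ‖e1‖ = 1 := by
  have h := norm_pt_eq_one_iff 1 0
  simpa [pt] using h

theorem norm_e2 : ‖e2‖ = 1 := by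
  have h := norm_pt_eq_one_iff 0 1
  simpa [pt] using h

/-- The integer coordinates of the cell of the rescaled lattice that contains `x`. -/
def cell (ε : ℝ) (x : Plane) : ℤ × ℤ := (⌊coord1 x / ε⌋, ⌊coord2 x / ε⌋)

theorem measurable_cell (ε : ℝ) : Measurable (cell ε) :=
  ((coord1.continuous.measurable.div_const ε).floor).prodMk
    ((coord2.continuous.measurable.div_const ε).floor)

theorem mem_convexHull_triple {p q r : Plane} {α β γ : ℝ} (hα : 0 ≤ α) (hβ : 0 ≤ β) (hγ : 0 ≤ γ)
    (h : α + β + γ = 1) : α • p + β • q + γ • r ∈ convexHull ℝ {p, q, r} := by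
  have := (convex_convexHull ℝ ({p, q, r} : Set Plane)).sum_mem (t := Finset.univ)
    (w := ![α, β, γ]) (z := ![p, q, r]) (by intro i _; fin_cases i <;> assumption)
    (by simpa [Fin.sum_univ_three] using h)
    (by intro i _; fin_cases i <;> exact subset_convexHull ℝ _ (by simp))
  simpa [Fin.sum_univ_three] using this

/-- Weak inequalities on a set become strict on its interior. -/
theorem lt_of_mem_interior {f : Plane →L[ℝ] ℝ} {e : Plane} (he : f e = 1) {s : Set Plane} {c : ℝ}
    (hs : ∀ x ∈ s, c ≤ f x) {x : Plane} (hx : x ∈ interior s) : c < f x := by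
  have hsurj : Function.Surjective f := fun t => ⟨t • e, by simp [he]⟩
  have hopen := (f.isOpenMap hsurj) _ (isOpen_interior (s := s))
  have hsub : f '' interior s ⊆ Set.Ici c := by
    rintro _ ⟨y, hy, rfl⟩
    exact hs y (interior_subset hy)
  have := interior_maximal hsub hopen ⟨x, hx, rfl⟩
  rwa [interior_Ici] at this

theorem le_of_mem_convexHull {f : Plane →L[ℝ] ℝ} {s : Set Plane} {c : ℝ}
    (hs : ∀ x ∈ s, c ≤ f x) : ∀ x ∈ convexHull ℝ s, c ≤ f x := by
  have : convexHull ℝ s ⊆ {x | c ≤ f x} :=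
    convexHull_min hs (convex_halfSpace_ge f.toLinearMap.isLinear c)
  exact fun x hx => this hx

section Interior

variable {ε : ℝ} {T : Triangle} {a b : ℤ} {x : Plane}

theorem Triangle.IsLower.of_mem_interior (hε : 0 < ε) (h : T.IsLower a b)
    (hx : x ∈ interior (T.carrier ε)) :
    ε * a < coord1 x ∧ ε * b < coord2 x ∧ coord1 x + coord2 x < ε * (a + b + 1) := by
  rw [Triangle.HasVertices.carrier_eq h] at hx
  refine ⟨?_, ?_, ?_⟩
  · refine lt_of_mem_interior coord1_e1 (le_of_mem_convexHull ?_) hx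
    rintro y (rfl | rfl | rfl) <;> (simp; try nlinarith)
  · refine lt_of_mem_interior coord2_e2 (le_of_mem_convexHull ?_) hx
    rintro y (rfl | rfl | rfl) <;> (simp; try nlinarith)
  · have := lt_of_mem_interior (f := -(coord1 + coord2)) (e := -e1) (c := -(ε * (a + b + 1)))
      (by simp) (le_of_mem_convexHull ?_) hx
    · simp at this
      linarith
    · rintro y (rfl | rfl | rfl) <;> simp <;> nlinarith

theorem Triangle.IsUpper.of_mem_interior (hε : 0 < ε) (h : T.IsUpper a b)
    (hx : x ∈ interior (T.carrier ε)) :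
    coord1 x < ε * (a + 1) ∧ coord2 x < ε * (b + 1) ∧ ε * (a + b + 1) < coord1 x + coord2 x := by
  rw [Triangle.HasVertices.carrier_eq h] at hx
  refine ⟨?_, ?_, ?_⟩
  · have := lt_of_mem_interior (f := -coord1) (e := -e1) (c := -(ε * (a + 1)))
      (by simp) (le_of_mem_convexHull ?_) hx
    · simp at this
      linarith
    · rintro y (rfl | rfl | rfl) <;> simp <;> nlinarith
  · have := lt_of_mem_interior (f := -coord2) (e := -e2) (c := -(ε * (b + 1)))
      (by simp) (le_of_mem_convexHull ?_) hx
    · simp at this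
      linarith
    · rintro y (rfl | rfl | rfl) <;> simp <;> nlinarith
  · refine lt_of_mem_interior (f := coord1 + coord2) (e := e1) (by simp)
      (le_of_mem_convexHull ?_) hx
    rintro y (rfl | rfl | rfl) <;> simp <;> nlinarith

theorem cell_eq_iff (hε : 0 < ε) : cell ε x = (a, b) ↔
    (ε * a ≤ coord1 x ∧ coord1 x < ε * (a + 1)) ∧ (ε * b ≤ coord2 x ∧ coord2 x < ε * (b + 1)) := by
  rw [cell, Prod.mk.injEq, Int.floor_eq_iff, Int.floor_eq_iff, le_div_iff₀' hε, div_lt_iff₀' hε,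
    le_div_iff₀' hε, div_lt_iff₀' hε]

theorem Triangle.IsLower.mem_interior (hε : 0 < ε) (h : T.IsLower a b)
    (h1 : ε * a < coord1 x) (h2 : ε * b < coord2 x)
    (h3 : coord1 x + coord2 x < ε * (a + b + 1)) : x ∈ interior (T.carrier ε) := by
  have hopen : IsOpen {y | ε * a < coord1 y ∧ ε * b < coord2 y ∧
      coord1 y + coord2 y < ε * (a + b + 1)} := by
    refine (isOpen_lt continuous_const coord1.continuous).inter
      ((isOpen_lt continuous_const coord2.continuous).inter
        (isOpen_lt (coord1.continuous.add coord2.continuous) continuous_const))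
  refine interior_maximal ?_ hopen ⟨h1, h2, h3⟩
  rintro y ⟨hy1, hy2, hy3⟩
  rw [Triangle.HasVertices.carrier_eq h]
  -- The offsets of `y / ε` from the corner `pt a b` are the barycentric weights of the other two
  -- vertices.
  have hs : 0 ≤ coord1 y / ε - a := by
    rw [sub_nonneg, le_div_iff₀' hε]; exact hy1.le
  have ht : 0 ≤ coord2 y / ε - b := by
    rw [sub_nonneg, le_div_iff₀' hε]; exact hy2.le
  have hst : 0 ≤ 1 - (coord1 y / ε - a) - (coord2 y / ε - b) := by
    have : (coord1 y + coord2 y) / ε ≤ a + b + 1 := (div_le_iff₀' hε).mpr hy3.le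
    rw [add_div] at this
    linarith
  convert mem_convexHull_triple hst hs ht (by ring) using 1
  conv_lhs => rw [eq_coord y]
  simp only [pt, smul_add, smul_smul, Int.cast_add, Int.cast_one]
  match_scalars <;> field_simp <;> ring

theorem Triangle.IsUpper.mem_interior (hε : 0 < ε) (h : T.IsUpper a b)
    (h1 : coord1 x < ε * (a + 1)) (h2 : coord2 x < ε * (b + 1))
    (h3 : ε * (a + b + 1) < coord1 x + coord2 x) : x ∈ interior (T.carrier ε) := by
  have hopen : IsOpen {y | coord1 y < ε * (a + 1) ∧ coord2 y < ε * (b + 1) ∧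
      ε * (a + b + 1) < coord1 y + coord2 y} := by
    refine (isOpen_lt coord1.continuous continuous_const).inter
      ((isOpen_lt coord2.continuous continuous_const).inter
        (isOpen_lt continuous_const (coord1.continuous.add coord2.continuous)))
  refine interior_maximal ?_ hopen ⟨h1, h2, h3⟩
  rintro y ⟨hy1, hy2, hy3⟩
  rw [Triangle.HasVertices.carrier_eq h]
  -- Here the weights are the offsets from the opposite corner `pt (a + 1) (b + 1)`; the second
  -- coordinate gives the weight of `pt (a + 1) b`.
  have hs : 0 ≤ b + 1 - coord2 y / ε := by
    rw [sub_nonneg, div_le_iff₀' hε]; exact hy2.le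
  have ht : 0 ≤ a + 1 - coord1 y / ε := by
    rw [sub_nonneg, div_le_iff₀' hε]; exact hy1.le
  have hst : 0 ≤ 1 - (b + 1 - coord2 y / ε) - (a + 1 - coord1 y / ε) := by
    have : a + b + 1 ≤ (coord1 y + coord2 y) / ε := (le_div_iff₀' hε).mpr hy3.le
    rw [add_div] at this
    linarith
  convert mem_convexHull_triple hst hs ht (by ring) using 1
  conv_lhs => rw [eq_coord y]
  simp only [pt, smul_add, smul_smul, Int.cast_add, Int.cast_one]
  match_scalars <;> field_simp <;> ring

end Interior

/-! ### Chirality, sign and excess as functions on the plane -/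

/-- Almost every point avoids a countable family of parallel lines. -/
theorem ae_notMem_of_countable {f : Plane →L[ℝ] ℝ} {e : Plane} (he : f e = 1) {s : Set ℝ}
    (hs : s.Countable) : ∀ᵐ x : Plane, f x ∉ s := by
  have hsurj : Function.Surjective f.toLinearMap := fun t => ⟨t • e, by simp [he]⟩
  exact (ae_comp_linearMap_mem_iff f.toLinearMap volume (volume : Measure ℝ) hsurj
    hs.measurableSet.compl).mpr (hs.ae_notMem volume)

section Fields

variable {ε : ℝ}

/-- The chirality as a function of the cell and of the position within the cell. -/
def cellChirality (u : SpinField ε) (x : Plane) : ℝ :=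
  if coord1 x + coord2 x < ε * ((cell ε x).1 + (cell ε x).2 + 1) then
    lowerChirality u (cell ε x).1 (cell ε x).2
  else upperChirality u (cell ε x).1 (cell ε x).2

theorem measurable_comp_cell {α : Type*} [MeasurableSpace α] (g : ℤ → ℤ → α) :
    Measurable fun x => g (cell ε x).1 (cell ε x).2 :=
  (measurable_of_countable fun p : ℤ × ℤ => g p.1 p.2).comp (measurable_cell ε)

theorem measurable_cellChirality (u : SpinField ε) : Measurable (cellChirality u) := by
  refine Measurable.ite ?_ (measurable_comp_cell _) (measurable_comp_cell _)
  exact measurableSet_lt (coord1.continuous.add coord2.continuous).measurable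
    (measurable_comp_cell fun a b => ε * ((a : ℝ) + b + 1))

theorem abs_cellChirality_le (u : SpinField ε) (x : Plane) : |cellChirality u x| ≤ 2 := by
  unfold cellChirality
  split_ifs
  · exact abs_lowerChirality_le _ _ _
  · exact abs_upperChirality_le _ _ _

/-- This holds for every triangle with `x` in its interior, so the choice made in `chirality` is
immaterial. -/
theorem triangleChirality_eq_cellChirality (hε : 0 < ε) (u : SpinField ε) {T : Triangle}
    {x : Plane} (hx : x ∈ interior (T.carrier ε)) :
    triangleChirality u T = cellChirality u x := by
  obtain ⟨a, b, h | h⟩ := T.isLower_or_isUpper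
  · obtain ⟨h1, h2, h3⟩ := h.of_mem_interior hε hx
    have hc : cell ε x = (a, b) := (cell_eq_iff hε).mpr
      ⟨⟨h1.le, by linarith⟩, h2.le, by linarith⟩
    rw [cellChirality, hc, if_pos h3, Triangle.HasVertices.chirality_eq h, lowerChirality]
  · obtain ⟨h1, h2, h3⟩ := h.of_mem_interior hε hx
    have hc : cell ε x = (a, b) := (cell_eq_iff hε).mpr
      ⟨⟨by linarith, h1⟩, by linarith, h2⟩
    rw [cellChirality, hc, if_neg h3.not_gt, Triangle.HasVertices.chirality_eq h, upperChirality]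

/-- The exceptional points lie on the lattice lines: three directions, countably many lines in each.
-/
theorem ae_exists_mem_interior (hε : 0 < ε) :
    ∀ᵐ x : Plane, ∃ T : Triangle, x ∈ interior (T.carrier ε) := by
  have hs : (Set.range fun k : ℤ => ε * k).Countable := Set.countable_range _
  filter_upwards [ae_notMem_of_countable coord1_e1 hs, ae_notMem_of_countable coord2_e2 hs,
    ae_notMem_of_countable (f := coord1 + coord2) (e := e1) (by simp) hs] with x h1 h2 h3
  obtain ⟨⟨a1, a2⟩, b1, b2⟩ := (cell_eq_iff hε).mp (rfl : cell ε x = ((cell ε x).1, (cell ε x).2))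
  set a := (cell ε x).1
  set b := (cell ε x).2
  have ha : ε * a < coord1 x := lt_of_le_of_ne a1 fun h => h1 ⟨a, h⟩
  have hb : ε * b < coord2 x := lt_of_le_of_ne b1 fun h => h2 ⟨b, h⟩
  rcases lt_trichotomy (coord1 x + coord2 x) (ε * (a + b + 1)) with h | h | h
  · obtain ⟨T, hT⟩ := exists_isLower a b
    exact ⟨T, hT.mem_interior hε ha hb h⟩
  · exact absurd ⟨a + b + 1, by push_cast; exact h.symm⟩ h3
  · obtain ⟨T, hT⟩ := exists_isUpper a b
    exact ⟨T, hT.mem_interior hε a2 b2 h⟩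

theorem chirality_ae_eq (hε : 0 < ε) (u : SpinField ε) :
    ∀ᵐ x : Plane, chirality u x = cellChirality u x := by
  filter_upwards [ae_exists_mem_interior hε] with x hx
  rw [chirality, dif_pos hx]
  exact triangleChirality_eq_cellChirality hε u hx.choose_spec

/-- The sign of the cell that contains `x`. -/
def signField (u : SpinField ε) (x : Plane) : ℝ := cellSign u (cell ε x).1 (cell ε x).2

/-- The excess of the cell that contains `x`. -/
def excessField (u : SpinField ε) (x : Plane) : ℝ := cellExcess u (cell ε x).1 (cell ε x).2

theorem measurable_signField (u : SpinField ε) : Measurable (signField u) :=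
  measurable_comp_cell _

theorem measurable_excessField (u : SpinField ε) : Measurable (excessField u) :=
  measurable_comp_cell _

theorem abs_signField (u : SpinField ε) (x : Plane) : |signField u x| = 1 := abs_cellSign _ _ _

theorem abs_cellChirality_sub_signField_le (u : SpinField ε) (x : Plane) {η : ℝ} (hη : 0 < η) :
    |cellChirality u x - signField u x| ≤ 12 * (η + excessField u x / η) := by
  have key : |cellChirality u x - signField u x| ≤ 12 * (‖lowerSum u (cell ε x).1 (cell ε x).2‖
      + ‖upperSum u (cell ε x).1 (cell ε x).2‖) := by
    unfold cellChirality signField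
    have := norm_nonneg (lowerSum u (cell ε x).1 (cell ε x).2)
    have := norm_nonneg (upperSum u (cell ε x).1 (cell ε x).2)
    split_ifs
    · have := abs_lowerChirality_sub_cellSign_le u (cell ε x).1 (cell ε x).2
      linarith
    · have := abs_upperChirality_sub_cellSign_le u (cell ε x).1 (cell ε x).2
      linarith
  refine key.trans ?_
  -- Young's inequality trades the norm for its square, which the energy controls, at the price of
  -- the free small parameter `η`.
  have young (s : ℝ) : s ≤ η / 2 + s ^ 2 / η / 2 := by
    have : 0 ≤ (η - s) ^ 2 / η / 2 := by positivity
    have h : (η - s) ^ 2 / η / 2 = η / 2 + s ^ 2 / η / 2 - s := by field_simp; ring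
    linarith
  have h1 := young ‖lowerSum u (cell ε x).1 (cell ε x).2‖
  have h2 := young ‖upperSum u (cell ε x).1 (cell ε x).2‖
  have h3 : 0 ≤ excessField u x / η := div_nonneg (cellExcess_nonneg _ _ _) hη.le
  have h4 : excessField u x / η = ‖lowerSum u (cell ε x).1 (cell ε x).2‖ ^ 2 / η
      + ‖upperSum u (cell ε x).1 (cell ε x).2‖ ^ 2 / η := by
    rw [excessField, cellExcess, add_div]
  linarith

end Fields

/-! ### Excess and translation estimates in terms of the energy -/

section Estimates

variable {ε : ℝ}

/-- The part of the energy carried by an injective family of triangles. -/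
theorem tsum_indicator_triangleEnergy_le {ι : Type*} {τ : ι → Triangle}
    (hτ : Function.Injective τ) (u : SpinField ε) (Ω : Set Plane) :
    ∑' p, {p | (τ p).carrier ε ⊆ Ω}.indicator
      (fun p => ENNReal.ofReal (triangleEnergy u (τ p))) p ≤ energy u Ω := by
  rw [← tsum_subtype]
  let φ : {p | (τ p).carrier ε ⊆ Ω} → {T : Triangle // T.carrier ε ⊆ Ω} := fun p => ⟨τ p.1, p.2⟩
  have hφ : Function.Injective φ := fun p q h => Subtype.ext (hτ (congrArg Subtype.val h))
  exact ENNReal.tsum_comp_le_tsum_of_injective hφ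
    fun T : {T : Triangle // T.carrier ε ⊆ Ω} => ENNReal.ofReal (triangleEnergy u T.1)

/-- A ball of radius `2 * ε` around any point of a cell thus contains both its triangles; all safety
margins to the boundary of `Ω` build on this. -/
theorem norm_sub_smul_pt_le (hε : 0 < ε) {x : Plane} {a b c d : ℤ} (hx : cell ε x = (a, b))
    (hc : c = a ∨ c = a + 1) (hd : d = b ∨ d = b + 1) : ‖ε • pt c d - x‖ ≤ 2 * ε := by
  obtain ⟨⟨h1, h2⟩, h3, h4⟩ := (cell_eq_iff hε).mp hx
  have h : ε • pt c d - x = (ε * c - coord1 x) • e1 + (ε * d - coord2 x) • e2 := by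
    conv_lhs => rw [eq_coord x]
    simp only [pt]
    module
  have hc' : |ε * c - coord1 x| ≤ ε := by
    rcases hc with rfl | rfl
    · rw [abs_le]; constructor <;> linarith
    · push_cast; rw [abs_le]; constructor <;> linarith
  have hd' : |ε * d - coord2 x| ≤ ε := by
    rcases hd with rfl | rfl
    · rw [abs_le]; constructor <;> linarith
    · push_cast; rw [abs_le]; constructor <;> linarith
  rw [h]
  refine (norm_add_le _ _).trans ?_
  rw [norm_smul, norm_smul, norm_e1, norm_e2, Real.norm_eq_abs, Real.norm_eq_abs]
  linarith

theorem Triangle.IsLower.carrier_subset (hε : 0 < ε) {T : Triangle} {a b : ℤ}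
    (h : T.IsLower a b) {x : Plane} (hx : cell ε x = (a, b)) :
    T.carrier ε ⊆ Metric.closedBall x (2 * ε) := by
  rw [Triangle.HasVertices.carrier_eq h]
  refine convexHull_min ?_ (convex_closedBall x _)
  rintro y (rfl | rfl | rfl) <;> rw [mem_closedBall_iff_norm] <;>
    exact norm_sub_smul_pt_le hε hx (by simp) (by simp)

theorem Triangle.IsUpper.carrier_subset (hε : 0 < ε) {T : Triangle} {a b : ℤ}
    (h : T.IsUpper a b) {x : Plane} (hx : cell ε x = (a, b)) :
    T.carrier ε ⊆ Metric.closedBall x (2 * ε) := by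
  rw [Triangle.HasVertices.carrier_eq h]
  refine convexHull_min ?_ (convex_closedBall x _)
  rintro y (rfl | rfl | rfl) <;> rw [mem_closedBall_iff_norm] <;>
    exact norm_sub_smul_pt_le hε hx (by simp) (by simp)

/-- A bound for the area of a cell. -/
theorem volume_cell_preimage_le (hε : 0 < ε) (p : ℤ × ℤ) :
    volume (cell ε ⁻¹' {p}) ≤
      ENNReal.ofReal (4 * ε ^ 2) * volume (Metric.ball (0 : Plane) 1) := by
  have hsub : cell ε ⁻¹' {p} ⊆ Metric.closedBall (ε • pt p.1 p.2) (2 * ε) := by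
    intro x hx
    rw [mem_closedBall_iff_norm, norm_sub_rev]
    exact norm_sub_smul_pt_le hε (a := p.1) (b := p.2) hx (by simp) (by simp)
  refine (measure_mono hsub).trans_eq ?_
  rw [Measure.addHaar_closedBall _ _ (by positivity), finrank_euclideanSpace_fin]
  congr 2
  ring

theorem exists_lower_family : ∃ τ : ℤ × ℤ → Triangle, Function.Injective τ ∧
    ∀ p, (τ p).IsLower p.1 p.2 := by
  choose τ hτ using fun p : ℤ × ℤ => exists_isLower p.1 p.2
  refine ⟨τ, fun p q h => ?_, hτ⟩
  have h1 := (hτ p).add_eq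
  rw [h, (hτ q).add_eq] at h1
  obtain ⟨h2, h3⟩ := pt_injective h1
  exact Prod.ext (by omega) (by omega)

theorem exists_upper_family : ∃ τ : ℤ × ℤ → Triangle, Function.Injective τ ∧
    ∀ p, (τ p).IsUpper p.1 p.2 := by
  choose τ hτ using fun p : ℤ × ℤ => exists_isUpper p.1 p.2
  refine ⟨τ, fun p q h => ?_, hτ⟩
  have h1 := (hτ p).add_eq
  rw [h, (hτ q).add_eq] at h1
  obtain ⟨h2, h3⟩ := pt_injective h1
  exact Prod.ext (by omega) (by omega)

/-- The area constant in the excess estimate. -/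
def excessConst : ℝ≥0∞ := 8 * volume (Metric.ball (0 : Plane) 1)

theorem excessConst_ne_top : excessConst ≠ ⊤ :=
  ENNReal.mul_ne_top (by simp) measure_ball_lt_top.ne

/-- The integral of the excess is controlled by the energy. -/
theorem lintegral_excessField_le (hε : 0 < ε) (u : SpinField ε) {A Ω : Set Plane}
    (hAΩ : ∀ x ∈ A, Metric.closedBall x (2 * ε) ⊆ Ω) :
    ∫⁻ x in A, ENNReal.ofReal (excessField u x) ≤
      excessConst * ENNReal.ofReal ε * energy u Ω := by
  obtain ⟨τ, hτi, hτ⟩ := exists_lower_family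
  obtain ⟨τ', hτi', hτ'⟩ := exists_upper_family
  have hmap : ∫⁻ x in A, ENNReal.ofReal (excessField u x) =
      ∑' p : ℤ × ℤ, ENNReal.ofReal (cellExcess u p.1 p.2) *
        volume.restrict A (cell ε ⁻¹' {p}) := by
    have h := lintegral_map (μ := volume.restrict A)
      (measurable_of_countable fun p : ℤ × ℤ => ENNReal.ofReal (cellExcess u p.1 p.2))
      (measurable_cell ε)
    rw [lintegral_countable'] at h
    refine Eq.trans ?_ (h.symm.trans (tsum_congr fun p => ?_))
    · rfl
    · rw [Measure.map_apply (measurable_cell ε) (measurableSet_singleton p)]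
  set V := volume (Metric.ball (0 : Plane) 1)
  -- A cell that meets `A` has both triangles in `Ω`, and its area is at most `4 * ε ^ 2 * V`. One
  -- factor `ε` belongs to the energy, the other remains as the gain.
  have hterm (p : ℤ × ℤ) : ENNReal.ofReal (cellExcess u p.1 p.2) *
      volume.restrict A (cell ε ⁻¹' {p}) ≤ 4 * ENNReal.ofReal ε * V *
        ({p | (τ p).carrier ε ⊆ Ω}.indicator
          (fun p => ENNReal.ofReal (triangleEnergy u (τ p))) p
        + {p | (τ' p).carrier ε ⊆ Ω}.indicator
          (fun p => ENNReal.ofReal (triangleEnergy u (τ' p))) p) := by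
    rcases Set.eq_empty_or_nonempty (cell ε ⁻¹' {p} ∩ A) with he | ⟨x, hx, hxA⟩
    · rw [Measure.restrict_apply (measurable_cell ε (measurableSet_singleton p)), he]
      simp
    · have hx' : cell ε x = (p.1, p.2) := hx
      have h1 : p ∈ {p | (τ p).carrier ε ⊆ Ω} :=
        ((hτ p).carrier_subset hε hx').trans (hAΩ x hxA)
      have h2 : p ∈ {p | (τ' p).carrier ε ⊆ Ω} :=
        ((hτ' p).carrier_subset hε hx').trans (hAΩ x hxA)
      rw [Set.indicator_of_mem h1, Set.indicator_of_mem h2, (hτ p).energy_eq, (hτ' p).energy_eq,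
        ← ENNReal.ofReal_add (by positivity) (by positivity), ← mul_add, ← cellExcess]
      calc _ ≤ ENNReal.ofReal (cellExcess u p.1 p.2) * (ENNReal.ofReal (4 * ε ^ 2) * V) := by
            gcongr
            exact (Measure.restrict_apply_le _ _).trans (volume_cell_preimage_le hε p)
        _ = _ := by
            have h4 : (4 : ℝ≥0∞) = ENNReal.ofReal 4 := by simp
            rw [ENNReal.ofReal_mul hε.le, ENNReal.ofReal_mul (by norm_num), sq,
              ENNReal.ofReal_mul hε.le, ← h4]
            ring
  rw [hmap]
  refine (ENNReal.tsum_le_tsum hterm).trans ?_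
  rw [ENNReal.tsum_mul_left, ENNReal.tsum_add]
  -- Lower and upper triangles are each bounded by the whole energy, which turns `4` into the `8` of
  -- `excessConst`.
  calc _ ≤ 4 * ENNReal.ofReal ε * V * (energy u Ω + energy u Ω) := by
        gcongr
        · exact tsum_indicator_triangleEnergy_le hτi u Ω
        · exact tsum_indicator_triangleEnergy_le hτi' u Ω
    _ = _ := by
        rw [excessConst]
        ring

theorem cell_add_smul_e1 (ε : ℝ) (x : Plane) (t : ℝ) :
    cell ε (x + t • e1) = (⌊coord1 x / ε + t / ε⌋, (cell ε x).2) := by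
  simp [cell, add_div]

theorem cell_add_smul_e2 (ε : ℝ) (x : Plane) (t : ℝ) :
    cell ε (x + t • e2) = ((cell ε x).1, ⌊coord2 x / ε + t / ε⌋) := by
  simp [cell, add_div]

/-- A function on the integers varies between two points by at most the sum of its increments. -/
theorem abs_sub_le_sum_increments (σ : ℤ → ℝ) (a : ℤ) {k m : ℕ} (h : m ≤ k) :
    |σ (a + m) - σ a| ≤ ∑ j ∈ Finset.range k, |σ (a + j + 1) - σ (a + j)| := by
  have h1 : |σ (a + m) - σ a| ≤ ∑ j ∈ Finset.range m, |σ (a + j + 1) - σ (a + j)| := by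
    have := Finset.sum_range_sub (fun j : ℕ => σ (a + j)) m
    simp only [Nat.cast_zero, add_zero] at this
    rw [← this]
    refine (Finset.abs_sum_le_sum_abs _ _).trans_eq (Finset.sum_congr rfl fun j _ => ?_)
    push_cast
    rw [add_assoc]
  exact h1.trans (Finset.sum_le_sum_of_subset_of_nonneg (Finset.range_mono h)
    fun _ _ _ => abs_nonneg _)

/-- The natural number `m` counts the cell sides crossed; a shift of length `τ` can cross one more
than `⌊τ⌋₊`. -/
theorem floor_add_eq {α τ : ℝ} (hτ : 0 ≤ τ) :
    ∃ m : ℕ, m ≤ ⌊τ⌋₊ + 1 ∧ ⌊α + τ⌋ = ⌊α⌋ + m := by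
  have h1 := Int.le_floor_add α τ
  have h2 := Int.le_floor_add_floor α τ
  have h3 : (⌊τ⌋₊ : ℤ) = ⌊τ⌋ := Int.natCast_floor_eq_floor hτ
  exact ⟨(⌊α + τ⌋ - ⌊α⌋).toNat, by omega, by omega⟩

/-- Translates of the sign field differ by at most the excesses met on the way. -/
theorem abs_signField_add_sub_le_e1 (hε : 0 < ε) (u : SpinField ε) (x : Plane) {t : ℝ}
    (ht : 0 ≤ t) : |signField u (x + t • e1) - signField u x| ≤
      ∑ j ∈ Finset.range (⌊t / ε⌋₊ + 1), 216 * (excessField u (x + (ε * j) • e1)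
        + excessField u (x + (ε * (j + 1)) • e1)) := by
  obtain ⟨m, hm, hfl⟩ := floor_add_eq (α := coord1 x / ε) (div_nonneg ht hε.le)
  have h := abs_sub_le_sum_increments (fun a => cellSign u a (cell ε x).2) (cell ε x).1 hm
  rw [signField, signField, cell_add_smul_e1 ε, hfl]
  refine h.trans (Finset.sum_le_sum fun j _ => ?_)
  refine (abs_cellSign_right_sub_le u _ _).trans_eq ?_
  -- A translation by a multiple of `ε` moves the cell index by exactly that multiple, so excesses
  -- of shifted cells are values of the excess field at shifted points.
  have h1 : ε * j / ε = ((j : ℤ) : ℝ) := by field_simp; simp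
  have h2 : ε * ((j : ℝ) + 1) / ε = ((j + 1 : ℤ) : ℝ) := by field_simp; simp
  rw [excessField, excessField, cell_add_smul_e1 ε, cell_add_smul_e1 ε, h1, h2,
    Int.floor_add_intCast, Int.floor_add_intCast, ← add_assoc]
  rfl

theorem abs_signField_add_sub_le_e2 (hε : 0 < ε) (u : SpinField ε) (x : Plane) {t : ℝ}
    (ht : 0 ≤ t) : |signField u (x + t • e2) - signField u x| ≤
      ∑ j ∈ Finset.range (⌊t / ε⌋₊ + 1), 216 * (excessField u (x + (ε * j) • e2)
        + excessField u (x + (ε * (j + 1)) • e2)) := by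
  obtain ⟨m, hm, hfl⟩ := floor_add_eq (α := coord2 x / ε) (div_nonneg ht hε.le)
  have h := abs_sub_le_sum_increments (fun b => cellSign u (cell ε x).1 b) (cell ε x).2 hm
  rw [signField, signField, cell_add_smul_e2 ε, hfl]
  refine h.trans (Finset.sum_le_sum fun j _ => ?_)
  refine (abs_cellSign_top_sub_le u _ _).trans_eq ?_
  have h1 : ε * j / ε = ((j : ℤ) : ℝ) := by field_simp; simp
  have h2 : ε * ((j : ℝ) + 1) / ε = ((j + 1 : ℤ) : ℝ) := by field_simp; simp
  rw [excessField, excessField, cell_add_smul_e2 ε, cell_add_smul_e2 ε, h1, h2,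
    Int.floor_add_intCast, Int.floor_add_intCast, ← add_assoc]
  rfl

/-- The integral of a translated excess is controlled by the energy. -/
theorem lintegral_excessField_add_le (hε : 0 < ε) (u : SpinField ε) {A Ω : Set Plane} (v : Plane)
    (hAΩ : ∀ x ∈ A, Metric.closedBall (x + v) (2 * ε) ⊆ Ω) :
    ∫⁻ x in A, ENNReal.ofReal (excessField u (x + v)) ≤
      excessConst * ENNReal.ofReal ε * energy u Ω := by
  have h := (measurePreserving_add_right (volume : Measure Plane) v).setLIntegral_comp_emb
    (measurableEmbedding_addRight v) (fun y => ENNReal.ofReal (excessField u y)) A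
  refine h.trans_le (lintegral_excessField_le hε u ?_)
  rintro _ ⟨x, hx, rfl⟩
  exact hAΩ x hx

/-- The translation estimate for the sign field along a lattice direction. -/
theorem lintegral_signField_add_sub_le (hε : 0 < ε) (u : SpinField ε) {A Ω : Set Plane}
    {e : Plane} (he : e = e1 ∨ e = e2) {t : ℝ} (ht : 0 ≤ t)
    (hAΩ : ∀ x ∈ A, Metric.closedBall x (t + 4 * ε) ⊆ Ω) :
    ∫⁻ x in A, ‖signField u (x + t • e) - signField u x‖ₑ ≤
      432 * excessConst * ENNReal.ofReal (t + ε) * energy u Ω := by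
  have hne : ‖e‖ = 1 := by
    rcases he with rfl | rfl
    · exact norm_e1
    · exact norm_e2
  have hpt (x : Plane) : |signField u (x + t • e) - signField u x| ≤
      ∑ j ∈ Finset.range (⌊t / ε⌋₊ + 1), 216 * (excessField u (x + (ε * j) • e)
        + excessField u (x + (ε * (j + 1)) • e)) := by
    rcases he with rfl | rfl
    · exact abs_signField_add_sub_le_e1 hε u x ht
    · exact abs_signField_add_sub_le_e2 hε u x ht
  have hfloor : (⌊t / ε⌋₊ : ℝ) * ε ≤ t := by
    have := Nat.floor_le (div_nonneg ht hε.le)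
    rwa [le_div_iff₀ hε] at this
  have hm (v : Plane) : Measurable fun x => ENNReal.ofReal (excessField u (x + v)) :=
    ((measurable_excessField u).comp (measurable_id.add_const v)).ennreal_ofReal
  have hm₂ (v w : Plane) : Measurable fun x => ENNReal.ofReal (excessField u (x + v))
      + ENNReal.ofReal (excessField u (x + w)) := (hm v).add (hm w)
  -- The points visited are at distance at most `t + ε` from `x`, and their cells need `2 * ε` more,
  -- within the margin `t + 4 * ε`.
  have hball (c : ℝ) (hc0 : 0 ≤ c) (hc : c * ε ≤ t + ε) :
      ∫⁻ x in A, ENNReal.ofReal (excessField u (x + (ε * c) • e)) ≤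
        excessConst * ENNReal.ofReal ε * energy u Ω := by
    refine lintegral_excessField_add_le hε u _ fun x hx => ?_
    refine Set.Subset.trans ?_ (hAΩ x hx)
    refine Metric.closedBall_subset_closedBall' ?_
    rw [dist_eq_norm, add_sub_cancel_left, norm_smul, hne, Real.norm_eq_abs,
      abs_of_nonneg (by positivity)]
    linarith
  calc ∫⁻ x in A, ‖signField u (x + t • e) - signField u x‖ₑ
      ≤ ∫⁻ x in A, ∑ j ∈ Finset.range (⌊t / ε⌋₊ + 1),
          216 * (ENNReal.ofReal (excessField u (x + (ε * j) • e))
            + ENNReal.ofReal (excessField u (x + (ε * (j + 1)) • e))) := by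
        refine lintegral_mono fun x => ?_
        rw [← ofReal_norm, Real.norm_eq_abs]
        refine (ENNReal.ofReal_le_ofReal (hpt x)).trans_eq ?_
        have hG (y : Plane) : 0 ≤ excessField u y := cellExcess_nonneg _ _ _
        rw [ENNReal.ofReal_sum_of_nonneg fun j _ =>
          mul_nonneg (by norm_num) (add_nonneg (hG _) (hG _))]
        refine Finset.sum_congr rfl fun j _ => ?_
        rw [ENNReal.ofReal_mul (by norm_num), ENNReal.ofReal_add (hG _) (hG _)]
        norm_num
    _ = ∑ j ∈ Finset.range (⌊t / ε⌋₊ + 1),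
          216 * ((∫⁻ x in A, ENNReal.ofReal (excessField u (x + (ε * j) • e)))
            + ∫⁻ x in A, ENNReal.ofReal (excessField u (x + (ε * (j + 1)) • e))) := by
        rw [lintegral_finsetSum _ fun j _ => (hm₂ _ _).const_mul _]
        refine Finset.sum_congr rfl fun j _ => ?_
        rw [lintegral_const_mul _ (hm₂ _ _), lintegral_add_left (hm _)]
    _ ≤ ∑ j ∈ Finset.range (⌊t / ε⌋₊ + 1), 216 * (excessConst * ENNReal.ofReal ε * energy u Ω
          + excessConst * ENNReal.ofReal ε * energy u Ω) := by
        refine Finset.sum_le_sum fun j hj => ?_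
        have hj' : (j : ℝ) ≤ ⌊t / ε⌋₊ := by
          exact_mod_cast Nat.lt_succ_iff.mp (Finset.mem_range.mp hj)
        have hjε : (j : ℝ) * ε ≤ t := (mul_le_mul_of_nonneg_right hj' hε.le).trans hfloor
        gcongr
        · exact hball j (by positivity) (by linarith)
        · exact hball (j + 1) (by positivity) (by linarith)
    -- Each crossing costs a multiple of `ε` and there are about `t / ε` of them, so the mesh size
    -- cancels up to one step.
    _ = 432 * excessConst * (((⌊t / ε⌋₊ + 1 : ℕ) : ℝ≥0∞) * ENNReal.ofReal ε) * energy u Ω := by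
        rw [Finset.sum_const, Finset.card_range, nsmul_eq_mul]
        ring
    _ ≤ _ := by
        gcongr
        rw [← ENNReal.ofReal_natCast, ← ENNReal.ofReal_mul (by positivity)]
        apply ENNReal.ofReal_le_ofReal
        push_cast
        linarith

end Estimates

theorem enorm_le_ofReal {a c : ℝ} (h : |a| ≤ c) : ‖a‖ₑ ≤ ENNReal.ofReal c := by
  rw [← ofReal_norm]
  exact ENNReal.ofReal_le_ofReal h

/-- The parallelogram spanned by `r e1` and `r e2`. -/
def parallelogram (r : ℝ) : Set Plane :=
  {h | (0 ≤ coord1 h ∧ coord1 h ≤ r) ∧ 0 ≤ coord2 h ∧ coord2 h ≤ r}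

theorem norm_le_of_mem_parallelogram {r : ℝ} {h : Plane} (hh : h ∈ parallelogram r) :
    ‖h‖ ≤ 2 * r := by
  obtain ⟨⟨h1, h2⟩, h3, h4⟩ := hh
  rw [eq_coord h]
  refine (norm_add_le _ _).trans ?_
  rw [norm_smul, norm_smul, norm_e1, norm_e2, Real.norm_eq_abs, Real.norm_eq_abs,
    abs_of_nonneg h1, abs_of_nonneg h3]
  linarith

theorem measurableSet_parallelogram (r : ℝ) : MeasurableSet (parallelogram r) := by
  have h1 := coord1.continuous
  have h2 := coord2.continuous
  exact (((isClosed_le continuous_const h1).inter (isClosed_le h1 continuous_const)).inter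
    ((isClosed_le continuous_const h2).inter (isClosed_le h2 continuous_const))).measurableSet

theorem volume_parallelogram_ne_zero {r : ℝ} (hr : 0 < r) : volume (parallelogram r) ≠ 0 := by
  have h1 := coord1.continuous
  have h2 := coord2.continuous
  have hopen : IsOpen {h : Plane | (0 < coord1 h ∧ coord1 h < r) ∧ 0 < coord2 h ∧ coord2 h < r} :=
    ((isOpen_lt continuous_const h1).inter (isOpen_lt h1 continuous_const)).inter
      ((isOpen_lt continuous_const h2).inter (isOpen_lt h2 continuous_const))
  have hpos := hopen.measure_pos volume ⟨(r / 2) • e1 + (r / 2) • e2, by simp [hr]⟩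
  refine (hpos.trans_le (measure_mono ?_)).ne'
  rintro h ⟨⟨h1, h2⟩, h3, h4⟩
  exact ⟨⟨h1.le, h2.le⟩, h3.le, h4.le⟩

theorem volume_parallelogram_ne_top (r : ℝ) : volume (parallelogram r) ≠ ⊤ := by
  have hsub : parallelogram r ⊆ Metric.closedBall 0 (2 * r) := fun h hh => by
    simpa using norm_le_of_mem_parallelogram hh
  exact ((measure_mono hsub).trans_lt measure_closedBall_lt_top).ne

/-- The translation estimate for the sign field along the vectors of a parallelogram. -/
theorem lintegral_signField_add_sub_le_of_mem {ε : ℝ} (hε : 0 < ε) (u : SpinField ε)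
    {A Ω : Set Plane} {r δ : ℝ} (hεr : ε ≤ r) (hrδ : 6 * r ≤ δ)
    (hAΩ : ∀ x ∈ A, Metric.closedBall x δ ⊆ Ω) {h : Plane} (hh : h ∈ parallelogram r) :
    ∫⁻ x in A, ‖signField u (x + h) - signField u x‖ₑ ≤
      ENNReal.ofReal (4 * r) * (432 * excessConst * energy u Ω) := by
  obtain ⟨⟨h1, h2⟩, h3, h4⟩ := hh
  have hmeas (v : Plane) : Measurable fun x => signField u (x + v) :=
    (measurable_signField u).comp (measurable_id.add_const v)
  have hfirst : ∫⁻ x in A, ‖signField u (x + coord1 h • e1) - signField u x‖ₑ ≤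
      432 * excessConst * ENNReal.ofReal (coord1 h + ε) * energy u Ω :=
    lintegral_signField_add_sub_le hε u (Or.inl rfl) h1 fun x hx =>
      (Metric.closedBall_subset_closedBall (by linarith)).trans (hAΩ x hx)
  -- The second leg starts at distance up to `r` from `x` and needs a margin of up to `r + 4 * ε`,
  -- which explains `6 * r ≤ δ`.
  have hsecond : ∫⁻ x in A, ‖signField u (x + coord1 h • e1 + coord2 h • e2)
      - signField u (x + coord1 h • e1)‖ₑ ≤
      432 * excessConst * ENNReal.ofReal (coord2 h + ε) * energy u Ω := by
    have hemb := (measurePreserving_add_right (volume : Measure Plane)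
      (coord1 h • e1)).setLIntegral_comp_emb (measurableEmbedding_addRight _)
      (fun y => ‖signField u (y + coord2 h • e2) - signField u y‖ₑ) A
    refine hemb.trans_le (lintegral_signField_add_sub_le hε u (Or.inr rfl) h3 ?_)
    rintro _ ⟨x, hx, rfl⟩
    refine Set.Subset.trans (Metric.closedBall_subset_closedBall' ?_) (hAΩ x hx)
    rw [dist_eq_norm, add_sub_cancel_left, norm_smul, norm_e1, Real.norm_eq_abs, abs_of_nonneg h1]
    linarith
  calc ∫⁻ x in A, ‖signField u (x + h) - signField u x‖ₑ
      ≤ ∫⁻ x in A, (‖signField u (x + coord1 h • e1) - signField u x‖ₑ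
          + ‖signField u (x + coord1 h • e1 + coord2 h • e2)
            - signField u (x + coord1 h • e1)‖ₑ) := by
        refine lintegral_mono fun x => ?_
        have hx : x + h = x + coord1 h • e1 + coord2 h • e2 := by
          rw [add_assoc, ← eq_coord h]
        rw [hx]
        refine le_trans ?_ (add_comm _ _).le
        simp only [← edist_eq_enorm_sub]
        exact edist_triangle _ _ _
    _ = _ := lintegral_add_left ((hmeas _).sub (measurable_signField u)).enorm _
    _ ≤ _ := add_le_add hfirst hsecond
    _ = (ENNReal.ofReal (coord1 h + ε) + ENNReal.ofReal (coord2 h + ε))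
          * (432 * excessConst * energy u Ω) := by ring
    _ ≤ _ := by
        gcongr
        rw [← ENNReal.ofReal_add (by linarith) (by linarith)]
        exact ENNReal.ofReal_le_ofReal (by linarith)

theorem exists_closedBall_subset {K Ω : Set Plane} (hK : IsCompact K) (hΩ : IsOpen Ω)
    (hKΩ : K ⊆ Ω) : ∃ δ > 0, ∀ x ∈ K, Metric.closedBall x δ ⊆ Ω := by
  obtain ⟨δ, hδ, h⟩ := hK.exists_cthickening_subset_open hΩ hKΩ
  exact ⟨δ, hδ, fun x hx => (Metric.closedBall_subset_cthickening hx δ).trans h⟩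

/-! ### Compactness of the sign fields and comparison with the chirality -/

section Sequence

variable {Ω : Set Plane} {ε : ℕ → ℝ} {u : ∀ n, SpinField (ε n)} {E : ℝ≥0∞}

/-- Compactness of the sign fields. -/
theorem exists_subseq_signField (hΩ : IsOpen Ω) (hfin : volume Ω ≠ ⊤) (hε_pos : ∀ n, 0 < ε n)
    (hε : Tendsto ε atTop (𝓝 0)) (hE : E ≠ ⊤) (hu : ∀ n, energy (u n) Ω ≤ E) :
    ∃ s : ℕ → ℕ, StrictMono s ∧ ∃ χ : Plane → ℝ, MemLp χ 1 (volume.restrict Ω) ∧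
      Tendsto (fun n => eLpNorm (fun x => signField (u (s n)) x - χ x) 1 (volume.restrict Ω))
        atTop (𝓝 0) := by
  refine exists_subseq_tendsto_of_translate (f := fun n => signField (u n)) hΩ hfin
    (fun n => measurable_signField (u n)) (fun n x => (abs_signField (u n) x).le)
    fun K hK hKΩ η hη => ?_
  obtain ⟨δ, hδ, hball⟩ := exists_closedBall_subset hK hΩ hKΩ
  have hC : 432 * excessConst * E ≠ ⊤ :=
    ENNReal.mul_ne_top (ENNReal.mul_ne_top (by simp) excessConst_ne_top) hE
  obtain ⟨ρ, hρ0, hρ⟩ := ENNReal.exists_nnreal_pos_mul_lt hC hη.ne'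
  have hρ0' : (0 : ℝ) < ρ := hρ0
  -- The first entry keeps all translates inside `Ω`; the second makes the factor `4 * r` of the
  -- translation estimate at most `ρ`.
  set r := min (δ / 6) (ρ / 4) with hr
  have hr0 : 0 < r := lt_min (by linarith) (by linarith)
  have hrδ : 6 * r ≤ δ := by linarith [min_le_left (δ / 6) ((ρ : ℝ) / 4)]
  have hrρ : 4 * r ≤ ρ := by linarith [min_le_right (δ / 6) ((ρ : ℝ) / 4)]
  refine ⟨parallelogram r, measurableSet_parallelogram r, volume_parallelogram_ne_zero hr0,
    volume_parallelogram_ne_top r, fun x hx h hh => hball x hx ?_, ?_⟩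
  · rw [mem_closedBall_iff_norm, add_sub_cancel_left]
    exact (norm_le_of_mem_parallelogram hh).trans (by linarith)
  · filter_upwards [hε.eventually (gt_mem_nhds hr0)] with n hn h hh
    refine (lintegral_signField_add_sub_le_of_mem (hε_pos n) (u n) hn.le hrδ hball hh).trans ?_
    refine le_trans ?_ hρ.le
    have := hu n
    gcongr
    exact (ENNReal.ofReal_le_ofReal hrρ).trans_eq ENNReal.ofReal_coe_nnreal

/-- The chirality is asymptotically equal to the sign field. -/
theorem tendsto_lintegral_cellChirality_sub_signField (hΩ : IsOpen Ω) (hfin : volume Ω ≠ ⊤)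
    (hε_pos : ∀ n, 0 < ε n) (hε : Tendsto ε atTop (𝓝 0)) (hE : E ≠ ⊤)
    (hu : ∀ n, energy (u n) Ω ≤ E) :
    Tendsto (fun n => ∫⁻ x in Ω, ‖cellChirality (u n) x - signField (u n) x‖ₑ)
      atTop (𝓝 0) := by
  rw [ENNReal.tendsto_nhds_zero]
  intro η hη
  -- The factor `5` is `3` off `K`, from the uniform bounds `2` and `1`, and `2` on `K`, one for
  -- each term of Young's inequality with parameter `ρ`.
  obtain ⟨θ, hθ0, hθ⟩ := ENNReal.exists_nnreal_pos_mul_lt (a := 5) (by simp) hη.ne'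
  have hθ0' : (0 : ℝ≥0∞) < θ := by exact_mod_cast hθ0
  obtain ⟨K, hKΩ, hK, hKη⟩ := hΩ.measurableSet.exists_isCompact_sdiff_lt hfin hθ0'.ne'
  obtain ⟨δ, hδ, hball⟩ := exists_closedBall_subset hK hΩ hKΩ
  obtain ⟨ρ, hρ0, hρ⟩ := ENNReal.exists_nnreal_pos_mul_lt (a := 12 * volume K)
    (ENNReal.mul_ne_top (by simp) hK.measure_ne_top) hθ0'.ne'
  have hρ0' : (0 : ℝ) < ρ := hρ0
  set C := ENNReal.ofReal (12 / ρ) * (excessConst * E) with hCdef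
  have hC : C ≠ ⊤ := ENNReal.mul_ne_top ENNReal.ofReal_ne_top
    (ENNReal.mul_ne_top excessConst_ne_top hE)
  have hlim : Tendsto (fun n => C * ENNReal.ofReal (ε n)) atTop (𝓝 0) := by
    have h := ENNReal.Tendsto.const_mul (a := C) (ENNReal.tendsto_ofReal hε) (Or.inr hC)
    simpa using h
  filter_upwards [hlim.eventually (gt_mem_nhds hθ0'),
    hε.eventually (gt_mem_nhds (by linarith : 0 < δ / 2))] with n hn hnδ
  have hsplit : Ω = (Ω \ K) ∪ K := (Set.sdiff_union_of_subset hKΩ).symm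
  have hout : ∫⁻ x in Ω \ K, ‖cellChirality (u n) x - signField (u n) x‖ₑ ≤ 3 * θ := by
    calc _ ≤ ∫⁻ _ in Ω \ K, 3 := by
          refine lintegral_mono fun x => ?_
          have h1 := abs_cellChirality_le (u n) x
          have h2 := abs_signField (u n) x
          have h3 := enorm_le_ofReal (c := 3) ((abs_sub _ _).trans (by linarith :
            |cellChirality (u n) x| + |signField (u n) x| ≤ 3))
          simpa using h3
      _ = 3 * volume (Ω \ K) := by simp
      _ ≤ 3 * θ := by gcongr
  have hin : ∫⁻ x in K, ‖cellChirality (u n) x - signField (u n) x‖ₑ ≤ 2 * θ := by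
    calc _ ≤ ∫⁻ x in K, (ENNReal.ofReal (12 * ρ)
            + ENNReal.ofReal (12 / ρ) * ENNReal.ofReal (excessField (u n) x)) := by
          refine lintegral_mono fun x => ?_
          have h := enorm_le_ofReal (abs_cellChirality_sub_signField_le (u n) x hρ0')
          refine h.trans_eq ?_
          have hG : 0 ≤ excessField (u n) x := cellExcess_nonneg _ _ _
          rw [← ENNReal.ofReal_mul (by positivity),
            ← ENNReal.ofReal_add (by positivity) (by positivity)]
          congr 1
          ring
      _ = ENNReal.ofReal (12 * ρ) * volume K
            + ENNReal.ofReal (12 / ρ) * ∫⁻ x in K, ENNReal.ofReal (excessField (u n) x) := by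
          rw [lintegral_add_left measurable_const,
            lintegral_const_mul _ (measurable_excessField (u n)).ennreal_ofReal]
          simp
      _ ≤ θ + θ := by
          refine add_le_add ?_ ?_
          · refine le_trans (le_of_eq ?_) hρ.le
            rw [ENNReal.ofReal_mul (by norm_num), ENNReal.ofReal_coe_nnreal]
            norm_num
            ring
          · refine le_trans ?_ hn.le
            have h := lintegral_excessField_le (hε_pos n) (u n) (A := K) (Ω := Ω) fun x hx =>
              (Metric.closedBall_subset_closedBall (by linarith)).trans (hball x hx)
            calc _ ≤ ENNReal.ofReal (12 / ρ) *
                  (excessConst * ENNReal.ofReal (ε n) * E) := by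
                  gcongr
                  refine h.trans ?_
                  gcongr
                  exact hu n
              _ = _ := by
                  rw [hCdef]
                  ring
      _ = 2 * θ := (two_mul _).symm
  calc ∫⁻ x in Ω, ‖cellChirality (u n) x - signField (u n) x‖ₑ
      ≤ (∫⁻ x in Ω \ K, ‖cellChirality (u n) x - signField (u n) x‖ₑ)
        + ∫⁻ x in K, ‖cellChirality (u n) x - signField (u n) x‖ₑ := by
        conv_lhs => rw [hsplit]
        exact lintegral_union_le _ _ _
    _ ≤ 3 * θ + 2 * θ := add_le_add hout hin
    _ = θ * 5 := by ring
    _ ≤ η := hθ.le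

end Sequence

/-! ### Total variation and values of the limit -/

/-- The divergence in the coordinates with respect to `e1`, `e2`. -/
theorem divergence_eq {φ : Plane → Plane} (hφ : Differentiable ℝ φ) (x : Plane) :
    divergence φ x = fderiv ℝ (fun y => coord1 (φ y)) x e1
      + fderiv ℝ (fun y => coord2 (φ y)) x e2 := by
  -- The divergence is the trace of the derivative, computed here with `e1`, `e2` and the dual basis
  -- `coord1`, `coord2`.
  have h1 : fderiv ℝ (fun y => coord1 (φ y)) x e1 = coord1 (fderiv ℝ φ x e1) := by
    have := (coord1.hasFDerivAt.comp x (hφ x).hasFDerivAt).fderiv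
    exact congrArg (fun L : Plane →L[ℝ] ℝ => L e1) this
  have h2 : fderiv ℝ (fun y => coord2 (φ y)) x e2 = coord2 (fderiv ℝ φ x e2) := by
    have := (coord2.hasFDerivAt.comp x (hφ x).hasFDerivAt).fderiv
    exact congrArg (fun L : Plane →L[ℝ] ℝ => L e2) this
  have he1 : e1 = EuclideanSpace.single 0 1 := by
    ext m
    fin_cases m <;> simp [e1]
  have he2 : e2 = (1 / 2 : ℝ) • EuclideanSpace.single 0 1
      + (√3 / 2) • EuclideanSpace.single 1 1 := by
    ext m
    fin_cases m <;> simp [e2]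
  have h3 : √3 ≠ 0 := by positivity
  rw [h1, h2, he2, he1, divergence, Fin.sum_univ_two, map_add, map_smul, map_smul, coord1_apply,
    coord2_apply]
  simp only [PiLp.add_apply, PiLp.smul_apply, smul_eq_mul]
  field_simp
  ring

theorem abs_coord_le {c : Plane →L[ℝ] ℝ} (hc : c = coord1 ∨ c = coord2) (v : Plane) :
    |c v| ≤ 2 * ‖v‖ := by
  have h0 : |v 0| ≤ ‖v‖ := PiLp.norm_apply_le v 0
  have h1 : |v 1| ≤ ‖v‖ := PiLp.norm_apply_le v 1
  have h3 : (√3)⁻¹ ≤ 1 := inv_le_one_of_one_le₀ (Real.one_le_sqrt.mpr (by norm_num))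
  have h3' : 0 ≤ (√3)⁻¹ := by positivity
  have h4 : |(√3)⁻¹ * v 1| ≤ ‖v‖ := by
    rw [abs_mul, abs_of_nonneg h3']
    exact (mul_le_of_le_one_left (abs_nonneg _) h3).trans h1
  rcases hc with rfl | rfl
  · rw [coord1_apply]
    exact (abs_sub _ _).trans (by linarith)
  · rw [coord2_apply, mul_assoc, abs_mul, abs_two]
    linarith

/-- The difference quotients of a compactly supported function, tested with the sign field. -/
theorem enorm_setIntegral_signField_mul_le {ε : ℝ} (hε : 0 < ε) (u : SpinField ε)
    {Ω : Set Plane} {ψ : Plane → ℝ} (hψc : Continuous ψ)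
    (hψs : HasCompactSupport ψ) (hψb : ∀ x, |ψ x| ≤ 2) {e : Plane} (he : e = e1 ∨ e = e2)
    (hsub : ∀ x ∈ tsupport ψ, Metric.closedBall x (5 * ε) ⊆ Ω) :
    ‖∫ x in Ω, signField u x * ((-ε)⁻¹ • (ψ (x + (-ε) • e) - ψ x))‖ₑ ≤
      2 * (864 * excessConst * energy u Ω) := by
  have hne : ‖e‖ = 1 := by
    rcases he with rfl | rfl
    · exact norm_e1
    · exact norm_e2
  set f := signField u
  have hf : Measurable f := measurable_signField u
  have hfb (x : Plane) : ‖f x‖ ≤ 1 := (abs_signField u x).le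
  have hψi : Integrable ψ := hψc.integrable_of_hasCompactSupport hψs
  have hΩψ : ∀ x, ψ x ≠ 0 → x ∈ Ω := fun x hx =>
    hsub x (subset_tsupport ψ hx) (Metric.mem_closedBall_self (by positivity))
  have hΩψ' : ∀ x, ψ (x + (-ε) • e) ≠ 0 → x ∈ Ω := fun x hx => by
    refine hsub _ (subset_tsupport ψ hx) ?_
    rw [mem_closedBall_iff_norm, sub_add_cancel_left, norm_neg, norm_smul, hne, norm_neg,
      Real.norm_eq_abs, abs_of_pos hε]
    linarith
  have hi1 : Integrable fun x => f x * ψ x :=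
    hψi.bdd_mul hf.aestronglyMeasurable (ae_of_all _ hfb)
  have hi2 : Integrable fun x => f x * ψ (x + (-ε) • e) :=
    (hψi.comp_add_right _).bdd_mul hf.aestronglyMeasurable (ae_of_all _ hfb)
  have hi3 : Integrable fun x => f (x + ε • e) * ψ x :=
    hψi.bdd_mul (hf.comp (measurable_id.add_const _)).aestronglyMeasurable
      (ae_of_all _ fun x => hfb _)
  have hplane : ∫ x in Ω, f x * ((-ε)⁻¹ • (ψ (x + (-ε) • e) - ψ x))
      = ∫ x, f x * ((-ε)⁻¹ • (ψ (x + (-ε) • e) - ψ x)) := by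
    refine setIntegral_eq_integral_of_forall_compl_eq_zero fun x hx => ?_
    have h1 : ψ x = 0 := by_contra fun h => hx (hΩψ x h)
    have h2 : ψ (x + (-ε) • e) = 0 := by_contra fun h => hx (hΩψ' x h)
    rw [h1, h2, sub_zero, smul_zero, mul_zero]
  -- Discrete integration by parts. The backward difference of `ψ` becomes a forward difference of
  -- the sign field, as the translation estimate requires `0 ≤ t`.
  have hshift : ∫ x, f x * ψ (x + (-ε) • e) = ∫ x, f (x + ε • e) * ψ x := by
    rw [← integral_add_right_eq_self _ (ε • e)]
    refine integral_congr_ae (ae_of_all _ fun x => ?_)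
    simp [add_assoc]
  have heq : ∫ x in Ω, f x * ((-ε)⁻¹ • (ψ (x + (-ε) • e) - ψ x))
      = (-ε)⁻¹ * ∫ x, (f (x + ε • e) - f x) * ψ x := by
    have hpt : (fun x => f x * ((-ε)⁻¹ • (ψ (x + (-ε) • e) - ψ x)))
        = fun x => (-ε)⁻¹ * (f x * ψ (x + (-ε) • e) - f x * ψ x) := by
      funext x
      rw [smul_eq_mul]
      ring
    rw [hplane, hpt, integral_const_mul, integral_sub hi2 hi1, hshift, ← integral_sub hi3 hi1]
    simp only [sub_mul]
  -- With `t = ε` the margin `t + 4 * ε` is the assumed `5 * ε`, and `t + ε = 2 * ε` cancels the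
  -- quotient and turns `432` into `864`.
  have htrans : ∫⁻ x in tsupport ψ, ‖f (x + ε • e) - f x‖ₑ ≤
      432 * excessConst * ENNReal.ofReal (ε + ε) * energy u Ω :=
    lintegral_signField_add_sub_le hε u he hε.le fun x hx =>
      (Metric.closedBall_subset_closedBall (by linarith)).trans (hsub x hx)
  have hint : ‖∫ x, (f (x + ε • e) - f x) * ψ x‖ₑ ≤
      2 * (432 * excessConst * ENNReal.ofReal (ε + ε) * energy u Ω) := by
    refine (enorm_integral_le_lintegral_enorm _).trans ?_
    calc ∫⁻ x, ‖(f (x + ε • e) - f x) * ψ x‖ₑ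
        = ∫⁻ x in tsupport ψ, ‖(f (x + ε • e) - f x) * ψ x‖ₑ := by
          rw [setLIntegral_eq_of_support_subset]
          intro x hx
          refine subset_tsupport ψ fun h => hx ?_
          simp [h]
      _ ≤ ∫⁻ x in tsupport ψ, 2 * ‖f (x + ε • e) - f x‖ₑ := by
          refine lintegral_mono fun x => ?_
          rw [enorm_mul, mul_comm]
          gcongr
          simpa using enorm_le_ofReal (hψb x)
      _ = 2 * ∫⁻ x in tsupport ψ, ‖f (x + ε • e) - f x‖ₑ :=
          lintegral_const_mul _ ((hf.comp (measurable_id.add_const _)).sub hf).enorm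
      _ ≤ _ := by gcongr
  rw [heq, enorm_mul]
  calc _ ≤ ‖(-ε)⁻¹‖ₑ * (2 * (432 * excessConst * ENNReal.ofReal (ε + ε) * energy u Ω)) := by
        gcongr
    _ = (‖(-ε)⁻¹‖ₑ * ENNReal.ofReal ε) * (2 * (864 * excessConst * energy u Ω)) := by
        rw [ENNReal.ofReal_add hε.le hε.le]
        ring
    _ = _ := by
        rw [← ofReal_norm, ← ENNReal.ofReal_mul (norm_nonneg _), norm_inv, norm_neg,
          Real.norm_eq_abs, abs_of_pos hε, inv_mul_cancel₀ hε.ne', ENNReal.ofReal_one, one_mul]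

section Limit

variable {Ω : Set Plane} {ε : ℕ → ℝ} {u : ∀ n, SpinField (ε n)} {E : ℝ≥0∞} {χ : Plane → ℝ}

/-- The directional derivative of the limit is bounded as a measure. -/
theorem enorm_setIntegral_mul_fderiv_le (hΩ : IsOpen Ω) (hfin : volume Ω ≠ ⊤)
    (hε_pos : ∀ n, 0 < ε n) (hε : Tendsto ε atTop (𝓝 0)) (hu : ∀ n, energy (u n) Ω ≤ E)
    (hχ : MemLp χ 1 (volume.restrict Ω))
    (hlim : Tendsto (fun n => eLpNorm (fun x => signField (u n) x - χ x) 1 (volume.restrict Ω))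
      atTop (𝓝 0))
    {ψ : Plane → ℝ} (hψ : ContDiff ℝ 1 ψ) (hψs : HasCompactSupport ψ) (hψΩ : tsupport ψ ⊆ Ω)
    (hψb : ∀ x, |ψ x| ≤ 2) {e : Plane} (he : e = e1 ∨ e = e2) :
    ‖∫ x in Ω, χ x * fderiv ℝ ψ x e‖ₑ ≤ 2 * (864 * excessConst * E) := by
  have : IsFiniteMeasure ((volume : Measure Plane).restrict Ω) := ⟨by simpa using hfin.lt_top⟩
  have hne : ‖e‖ = 1 := by
    rcases he with rfl | rfl
    · exact norm_e1
    · exact norm_e2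
  obtain ⟨L, hL⟩ := ContDiff.lipschitzWith_of_hasCompactSupport hψs hψ (by simp)
  set q : ℕ → Plane → ℝ := fun n x => (-ε n)⁻¹ • (ψ (x + (-ε n) • e) - ψ x) with hq
  set D : Plane → ℝ := fun x => fderiv ℝ ψ x e with hD
  have hDc : Continuous D := (hψ.continuous_fderiv (by simp)).clm_apply continuous_const
  have hqc (n : ℕ) : Continuous (q n) := by
    have := hψ.continuous
    fun_prop
  have hqb (n : ℕ) (x : Plane) : ‖q n x‖ ≤ L := by
    have h := hL.dist_le_mul (x + (-ε n) • e) x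
    rw [dist_eq_norm, dist_eq_norm, add_sub_cancel_left, norm_smul, hne, mul_one] at h
    rw [hq]
    simp only
    rw [norm_smul, norm_inv, inv_mul_le_iff₀ (by simpa using (hε_pos n).ne')]
    linarith
  have hqD (x : Plane) : Tendsto (fun n => q n x) atTop (𝓝 (D x)) := by
    have h := ((hψ.differentiable (by simp) x).hasFDerivAt.hasLineDerivAt e).tendsto_slope_zero
    refine h.comp (tendsto_nhdsWithin_iff.mpr ⟨?_, .of_forall fun n => ?_⟩)
    · simpa using hε.neg
    · simpa using (hε_pos n).ne'
  have hDb (x : Plane) : ‖D x‖ ≤ L := le_of_tendsto' (hqD x).norm fun n => hqb n x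
  have hf (n : ℕ) : Measurable (signField (u n)) := measurable_signField (u n)
  have hfb (n : ℕ) (x : Plane) : ‖signField (u n) x‖ₑ ≤ 1 := by
    simpa using enorm_le_ofReal (abs_signField (u n) x).le
  have hquot : Tendsto (fun n => ∫⁻ x in Ω, ‖q n x - D x‖ₑ) atTop (𝓝 0) := by
    rw [← lintegral_zero (μ := volume.restrict Ω)]
    refine tendsto_lintegral_of_dominated_convergence (fun _ => ENNReal.ofReal (L + L))
      (fun n => ((hqc n).sub hDc).measurable.enorm) (fun n => ae_of_all _ fun x => ?_) ?_
      (ae_of_all _ fun x => ?_)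
    · exact enorm_le_ofReal ((norm_sub_le _ _).trans (add_le_add (hqb n x) (hDb x)))
    · simpa using ENNReal.mul_ne_top ENNReal.ofReal_ne_top hfin
    · simpa using ((hqD x).sub_const (D x)).enorm
  -- The sign fields are bounded by one and the quotients converge in `L¹`; the derivative is
  -- bounded by `L` and the sign fields converge in `L¹`. Hence the products converge in `L¹`.
  have hconv : Tendsto (fun n => ∫ x in Ω, signField (u n) x * q n x) atTop
      (𝓝 (∫ x in Ω, χ x * D x)) := by
    refine tendsto_integral_of_L1 _ (hχ.aestronglyMeasurable.mul hDc.aestronglyMeasurable)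
      (.of_forall fun n => ?_) ?_
    · refine Integrable.of_bound ((hf n).mul (hqc n).measurable).aestronglyMeasurable (1 * L)
        (ae_of_all _ fun x => ?_)
      rw [norm_mul]
      exact mul_le_mul (abs_signField (u n) x).le (hqb n x) (norm_nonneg _) zero_le_one
    · have hsum : Tendsto (fun n => (∫⁻ x in Ω, ‖q n x - D x‖ₑ) + ENNReal.ofReal L *
          eLpNorm (fun x => signField (u n) x - χ x) 1 (volume.restrict Ω)) atTop (𝓝 0) := by
        have h := hquot.add (ENNReal.Tendsto.const_mul (a := ENNReal.ofReal L) hlim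
          (Or.inr ENNReal.ofReal_ne_top))
        simpa using h
      refine tendsto_of_tendsto_of_tendsto_of_le_of_le tendsto_const_nhds hsum
        (fun n => zero_le) fun n => ?_
      rw [eLpNorm_one_eq_lintegral_enorm]
      calc ∫⁻ x in Ω, ‖signField (u n) x * q n x - χ x * D x‖ₑ
          ≤ ∫⁻ x in Ω, (‖q n x - D x‖ₑ + ENNReal.ofReal L * ‖signField (u n) x - χ x‖ₑ) := by
            refine lintegral_mono fun x => ?_
            have : signField (u n) x * q n x - χ x * D x
                = signField (u n) x * (q n x - D x) + D x * (signField (u n) x - χ x) := by ring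
            rw [this]
            refine (enorm_add_le _ _).trans ?_
            rw [enorm_mul, enorm_mul]
            exact add_le_add (mul_le_of_le_one_left zero_le (hfb n x))
              (mul_le_mul_left (enorm_le_ofReal (hDb x)) _)
        _ = _ := by
            have hm : Measurable fun x => ‖q n x - D x‖ₑ := ((hqc n).sub hDc).measurable.enorm
            rw [lintegral_add_left hm, lintegral_const_mul' _ _ ENNReal.ofReal_ne_top]
  obtain ⟨δ, hδ, hball⟩ := exists_closedBall_subset hψs.isCompact hΩ hψΩ
  refine le_of_tendsto hconv.enorm ?_
  filter_upwards [hε.eventually (gt_mem_nhds (by linarith : 0 < δ / 5))] with n hn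
  refine (enorm_setIntegral_signField_mul_le (hε_pos n) (u n) hψ.continuous hψs
    hψb he fun x hx => (Metric.closedBall_subset_closedBall (by linarith)).trans
      (hball x hx)).trans ?_
  gcongr
  exact hu n

/-- The limit of the sign fields has finite total variation. -/
theorem totalVariation_lt_top (hΩ : IsOpen Ω) (hfin : volume Ω ≠ ⊤)
    (hε_pos : ∀ n, 0 < ε n) (hε : Tendsto ε atTop (𝓝 0)) (hE : E ≠ ⊤)
    (hu : ∀ n, energy (u n) Ω ≤ E) (hχ : MemLp χ 1 (volume.restrict Ω))
    (hlim : Tendsto (fun n => eLpNorm (fun x => signField (u n) x - χ x) 1 (volume.restrict Ω))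
      atTop (𝓝 0)) :
    totalVariation χ Ω < ⊤ := by
  set M := 2 * (864 * excessConst * E) with hM
  have hMtop : M ≠ ⊤ := ENNReal.mul_ne_top (by simp)
    (ENNReal.mul_ne_top (ENNReal.mul_ne_top (by simp) excessConst_ne_top) hE)
  refine lt_of_le_of_lt (iSup₂_le fun φ hφ => ?_)
    (ENNReal.add_lt_top.mpr ⟨hMtop.lt_top, hMtop.lt_top⟩ : M + M < ⊤)
  obtain ⟨hφd, hφs, hφΩ, hφb⟩ := hφ
  have hχi : Integrable χ (volume.restrict Ω) := memLp_one_iff_integrable.mp hχ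
  have hcd (c : Plane →L[ℝ] ℝ) : ContDiff ℝ 1 fun y => c (φ y) := c.contDiff.comp hφd
  have hcs (c : Plane →L[ℝ] ℝ) : HasCompactSupport fun y => c (φ y) :=
    hφs.comp_left (map_zero c)
  have hcΩ (c : Plane →L[ℝ] ℝ) : tsupport (fun y => c (φ y)) ⊆ Ω :=
    (tsupport_comp_subset (map_zero c) φ).trans hφΩ
  have hdir {c : Plane →L[ℝ] ℝ} (hc : c = coord1 ∨ c = coord2) {e : Plane}
      (he : e = e1 ∨ e = e2) : ‖∫ x in Ω, χ x * fderiv ℝ (fun y => c (φ y)) x e‖ₑ ≤ M :=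
    enorm_setIntegral_mul_fderiv_le hΩ hfin hε_pos hε hu hχ hlim (hcd c) (hcs c) (hcΩ c)
      (fun x => (abs_coord_le hc _).trans (by linarith [hφb x])) he
  have hint (c : Plane →L[ℝ] ℝ) (e : Plane) :
      Integrable (fun x => χ x * fderiv ℝ (fun y => c (φ y)) x e) (volume.restrict Ω) := by
    have hcont : Continuous fun x => fderiv ℝ (fun y => c (φ y)) x e :=
      ((hcd c).continuous_fderiv (by simp)).clm_apply continuous_const
    have hsupp : HasCompactSupport fun x => fderiv ℝ (fun y => c (φ y)) x e :=
      (hcs c).fderiv_apply ℝ e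
    obtain ⟨C, hC⟩ := hcont.bounded_above_of_compact_support hsupp
    exact hχi.mul_bdd hcont.aestronglyMeasurable (ae_of_all _ hC)
  have heq : ∫ x in Ω, χ x * divergence φ x
      = (∫ x in Ω, χ x * fderiv ℝ (fun y => coord1 (φ y)) x e1)
        + ∫ x in Ω, χ x * fderiv ℝ (fun y => coord2 (φ y)) x e2 := by
    rw [← integral_add (hint coord1 e1) (hint coord2 e2)]
    simp only [divergence_eq (hφd.differentiable (by simp)), mul_add]
  calc ENNReal.ofReal (∫ x in Ω, χ x * divergence φ x)
      ≤ ‖∫ x in Ω, χ x * divergence φ x‖ₑ := Real.ofReal_le_enorm _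
    _ ≤ _ := by
        rw [heq]
        exact enorm_add_le _ _
    _ ≤ M + M := add_le_add (hdir (Or.inl rfl) (Or.inl rfl)) (hdir (Or.inr rfl) (Or.inr rfl))

/-- The limit of the sign fields takes the values `-1` and `1`. -/
theorem ae_eq_or_eq_of_tendsto (hχ : MemLp χ 1 (volume.restrict Ω))
    (hlim : Tendsto (fun n => eLpNorm (fun x => signField (u n) x - χ x) 1 (volume.restrict Ω))
      atTop (𝓝 0)) :
    ∀ᵐ x ∂(volume.restrict Ω), χ x = -1 ∨ χ x = 1 := by
  -- A further subsequence converges almost everywhere, and the set `{-1, 1}` is closed.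
  have hmeas := tendstoInMeasure_of_tendsto_eLpNorm (f := fun n => signField (u n)) one_ne_zero
    (fun n => (measurable_signField (u n)).aestronglyMeasurable) hχ.aestronglyMeasurable hlim
  obtain ⟨ns, -, hns⟩ := hmeas.exists_seq_tendsto_ae
  filter_upwards [hns] with x hx
  have hclosed : IsClosed ({-1, 1} : Set ℝ) := (Set.toFinite _).isClosed
  exact hclosed.mem_of_tendsto hx (.of_forall fun n => signOf_eq _)

end Limit

end TriXY

end

/-! ### Conclusion -/

theorem proposition3p1
    (Ω : Set TriXY.Plane) (hΩ_open : IsOpen Ω) (hΩ_bdd : Bornology.IsBounded Ω)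
    (ε : ℕ → ℝ) (hε_pos : ∀ n, 0 < ε n) (hε : Tendsto ε atTop (𝓝 0))
    (u : ∀ n, TriXY.SpinField (ε n))
    (hu : (⨆ n, TriXY.energy (u n) Ω) < ⊤) :
    (∀ n, IntegrableOn (TriXY.chirality (u n)) Ω) ∧
    ∃ χ : TriXY.Plane → ℝ, TriXY.MemBVSign χ Ω ∧
      ∃ s : ℕ → ℕ, StrictMono s ∧
        Tendsto (fun n => eLpNorm (fun x => TriXY.chirality (u (s n)) x - χ x) 1
          (volume.restrict Ω)) atTop (𝓝 0) := by
  have hfin : volume Ω ≠ ⊤ := hΩ_bdd.measure_lt_top.ne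
  have : IsFiniteMeasure ((volume : Measure TriXY.Plane).restrict Ω) :=
    ⟨by simpa using hfin.lt_top⟩
  have hE (n : ℕ) : TriXY.energy (u n) Ω ≤ ⨆ n, TriXY.energy (u n) Ω :=
    le_iSup (fun n => TriXY.energy (u n) Ω) n
  have hae (n : ℕ) : TriXY.chirality (u n) =ᵐ[volume.restrict Ω] TriXY.cellChirality (u n) :=
    ae_restrict_of_ae (TriXY.chirality_ae_eq (hε_pos n) (u n))
  refine ⟨fun n => ?_, ?_⟩
  · refine Integrable.congr ?_ (hae n).symm
    exact Integrable.of_bound (TriXY.measurable_cellChirality (u n)).aestronglyMeasurable 2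
      (ae_of_all _ fun x => TriXY.abs_cellChirality_le (u n) x)
  · obtain ⟨s, hs, χ, hχ, hlim⟩ :=
      TriXY.exists_subseq_signField hΩ_open hfin hε_pos hε hu.ne hE
    have hεs : Tendsto (fun n => ε (s n)) atTop (𝓝 0) := hε.comp hs.tendsto_atTop
    refine ⟨χ, ⟨memLp_one_iff_integrable.mp hχ,
      TriXY.totalVariation_lt_top (u := fun n => u (s n)) hΩ_open hfin (fun n => hε_pos (s n))
        hεs hu.ne (fun n => hE (s n)) hχ hlim,
      TriXY.ae_eq_or_eq_of_tendsto (u := fun n => u (s n)) hχ hlim⟩, s, hs, ?_⟩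
    have hchir := TriXY.tendsto_lintegral_cellChirality_sub_signField
      (u := fun n => u (s n)) hΩ_open hfin (fun n => hε_pos (s n)) hεs hu.ne (fun n => hE (s n))
    -- The `L¹` distance from the chirality to the limit is at most its distance to the sign field
    -- plus the distance from there to the limit.
    have hsum := hchir.add hlim
    rw [add_zero] at hsum
    refine tendsto_of_tendsto_of_tendsto_of_le_of_le tendsto_const_nhds hsum
      (fun n => zero_le) fun n => ?_
    have hcongr : eLpNorm (fun x => TriXY.chirality (u (s n)) x - χ x) 1 (volume.restrict Ω)
        = ∫⁻ x in Ω, ‖TriXY.cellChirality (u (s n)) x - χ x‖ₑ := by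
      rw [eLpNorm_one_eq_lintegral_enorm]
      refine lintegral_congr_ae ((hae (s n)).mono fun x hx => ?_)
      simp only [hx]
    simp only [hcongr, eLpNorm_one_eq_lintegral_enorm]
    have hm : Measurable fun x =>
        ‖TriXY.cellChirality (u (s n)) x - TriXY.signField (u (s n)) x‖ₑ :=
      ((TriXY.measurable_cellChirality (u (s n))).sub
        (TriXY.measurable_signField (u (s n)))).enorm
    rw [← lintegral_add_left hm]
    refine lintegral_mono fun x => ?_
    simp only [← edist_eq_enorm_sub]
    exact edist_triangle _ _ _
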